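/- **Conventions.** For a real random variable $W$ and $\alpha>0$ let $$\|W\|_{\psi_\alpha}:=\inf\{\eta>0:\ \mathbb E[\exp((|W|/\eta)^\alpha)-1]\le 1\}\in[0,\infty]\qquad(\inf\emptyset=\infty).$$ For a random vector $X=(X(1),\dots,X(p))^\top\in\mathbb R^p$ let $$\|X\|_{M,\psi_\alpha}:=\sup_{1\le j\le p}\|X(j)\|_{\psi_\alpha},\qquad \|X\|_{J,\psi_\alpha}:=\sup_{\theta\in\mathbb R^p,\ \|\theta\|_2=1}\|X^\top\theta\|_{\psi_\alpha}.$$ For $\theta\in\mathbb R^p$ let $\|\theta\|_0$ be the number of its non-zero entries. **Theorem.** Fix $0<\alpha\le 2$. There is a constant $C_\alpha>0$, depending only on $\alpha$, such that the following holds. Let $n\ge 1$ and $1\le k\le p$ be integers, and let $X_1,\dots,X_n$ be independent (not necessarily identically distributed or centred) random vectors in $\mathbb R^p$. Put $$\hat\Sigma_n:=\frac1n\sum_{i=1}^nX_iX_i^\top,\qquad \Sigma_n:=\frac1n\sum_{i=1}^n\mathbb E[X_iX_i^\top],\qquad \mathrm{RIP}_n(k):=\sup_{\|\theta\|_0\le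 k,\ \|\theta\|_2\le 1}\left|\theta^\top(\hat\Sigma_n-\Sigma_n)\theta\right|,$$ $$\Upsilon_{n,k}:=\sup_{\|\theta\|_0\le k,\ \|\theta\|_2=1}\ \frac1n\sum_{i=1}^n\mathrm{Var}\left((X_i^\top\theta)^2\right).$$ Let $0\le K_{n,p}<\infty$. (a) If $\|X_i\|_{M,\psi_\alpha}\le K_{n,p}$ for all $1\le i\le n$, then for every $t>0$, with probability at least $1-3e^{-t}$, $$\mathrm{RIP}_n(k)\le 14\sqrt{\frac{\Upsilon_{n,k}\,(t+k\log(36p/k))}{n}}+\frac{C_\alpha K_{n,p}^2\,k\,(\log(2n))^{2/\alpha}(t+k\log(36p/k))^{2/\alpha}}{n}.$$ (b) If $\|X_i\|_{J,\psi_\alpha}\le K_{n,p}$ for all $1\le i\le n$, then for every $t>0$, with probability at least $1-3e^{-t}$, $$\mathrm{RIP}_n(k)\le 14\sqrt{\frac{\Upsilon_{n,k}\,(t+k\log(36p/k))}{n}}+\frac{C_\alpha K_{n,p}^2\,(\log(2n))^{2/\alpha}(t+k\log(36p/k))^{2/\alpha}}{n}.$$ -/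

import Mathlib

open MeasureTheory ProbabilityTheory
open scoped ENNReal NNReal

noncomputable section

namespace SubWeibull

/-- The function `ψ_α(x) = exp(x^α) - 1`, used for `x ≥ 0`. -/
def psi (α x : ℝ) : ℝ := Real.exp (x ^ α) - 1

/-- The `g`-Orlicz norm `inf {η > 0 : E[g(|X|/η)] ≤ 1}` of a real random variable, as an extended
nonnegative number: it is `∞` when no `η > 0` qualifies. For nonnegative `g` the expectation is the
Lebesgue integral with values in `[0, ∞]`. -/
def orliczNorm {Ω : Type*} [MeasurableSpace Ω] (μ : Measure Ω) (g : ℝ → ℝ) (X : Ω → ℝ) : ℝ≥0∞ :=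
  ⨅ (η : ℝ) (_ : 0 < η) (_ : ∫⁻ ω, ENNReal.ofReal (g (|X ω| / η)) ∂μ ≤ 1), ENNReal.ofReal η

/-- The sub-Weibull norm `‖X‖_{ψ_α}` of a real random variable. -/
def psiNorm {Ω : Type*} [MeasurableSpace Ω] (μ : Measure Ω) (α : ℝ) (X : Ω → ℝ) : ℝ≥0∞ :=
  orliczNorm μ (psi α) X

/-- The marginal sub-Weibull norm `‖X‖_{M,ψ_α} = sup_j ‖X(j)‖_{ψ_α}` of a random vector. -/
def marginalNorm {Ω : Type*} [MeasurableSpace Ω] (μ : Measure Ω) (α : ℝ) {p : ℕ}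
    (X : Ω → EuclideanSpace ℝ (Fin p)) : ℝ≥0∞ :=
  ⨆ j : Fin p, psiNorm μ α (fun ω => X ω j)

/-- The joint sub-Weibull norm `‖X‖_{J,ψ_α} = sup_{‖θ‖₂ = 1} ‖Xᵀθ‖_{ψ_α}` of a random vector. -/
def jointNorm {Ω : Type*} [MeasurableSpace Ω] (μ : Measure Ω) (α : ℝ) {p : ℕ}
    (X : Ω → EuclideanSpace ℝ (Fin p)) : ℝ≥0∞ :=
  ⨆ (θ : EuclideanSpace ℝ (Fin p)) (_ : ‖θ‖ = 1), psiNorm μ α (fun ω => inner ℝ (X ω) θ)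

/-- The number `‖θ‖₀` of non-zero entries of `θ`. -/
def l0 {p : ℕ} (θ : EuclideanSpace ℝ (Fin p)) : ℕ := {j : Fin p | θ j ≠ 0}.ncard

/-- The sample Gram matrix `(1/n) ∑ᵢ Xᵢ Xᵢᵀ`. -/
def sampleGram {Ω : Type*} {n p : ℕ} (X : Fin n → Ω → EuclideanSpace ℝ (Fin p)) (ω : Ω) :
    Matrix (Fin p) (Fin p) ℝ :=
  (1 / (n : ℝ)) • ∑ i, Matrix.vecMulVec (X i ω).ofLp (X i ω).ofLp

/-- The population Gram matrix `(1/n) ∑ᵢ E[Xᵢ Xᵢᵀ]`, with entrywise expectations. -/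
def populationGram {Ω : Type*} [MeasurableSpace Ω] (μ : Measure Ω) {n p : ℕ}
    (X : Fin n → Ω → EuclideanSpace ℝ (Fin p)) : Matrix (Fin p) (Fin p) ℝ :=
  (1 / (n : ℝ)) • ∑ i, Matrix.of fun j l => ∫ ω, X i ω j * X i ω l ∂μ

/-- The random variable `RIP_n(k)`: the supremum of `|θᵀ (Σ̂ₙ - Σₙ) θ|` over all `θ` with
`‖θ‖₀ ≤ k` and `‖θ‖₂ ≤ 1`. -/
def RIP {Ω : Type*} [MeasurableSpace Ω] (μ : Measure Ω) {n p : ℕ}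
    (X : Fin n → Ω → EuclideanSpace ℝ (Fin p)) (k : ℕ) (ω : Ω) : ℝ :=
  sSup ((fun θ : EuclideanSpace ℝ (Fin p) =>
      |dotProduct θ.ofLp ((sampleGram X ω - populationGram μ X).mulVec θ.ofLp)|) ''
    {θ | l0 θ ≤ k ∧ ‖θ‖ ≤ 1})

/-- The set `Θ_k` of `k`-sparse Euclidean unit vectors. -/
def sparseSphere (p k : ℕ) : Set (EuclideanSpace ℝ (Fin p)) := {θ | l0 θ ≤ k ∧ ‖θ‖ = 1}

/-- The quantity `Υ_{n,k}`: the supremum over `θ ∈ Θ_k` of `(1/n) ∑ᵢ Var((Xᵢᵀθ)²)`. -/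
def Upsilon {Ω : Type*} [MeasurableSpace Ω] (μ : Measure Ω) {n p : ℕ}
    (X : Fin n → Ω → EuclideanSpace ℝ (Fin p)) (k : ℕ) : ℝ :=
  sSup ((fun θ : EuclideanSpace ℝ (Fin p) =>
      (1 / (n : ℝ)) * ∑ i, variance (fun ω => (inner ℝ (X i ω) θ) ^ 2) μ) ''
    sparseSphere p k)

end SubWeibull

end

/-! At a fixed sparse unit vector θ, the quadratic form of the Gram difference is an average of
independent centred variables (Xᵢᵀθ)² - E(Xᵢᵀθ)². Squaring halves the tail exponent, so these have
exponential moments of order β = α/2 ≤ 1, and 2/α = 1/β.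

Concentration at fixed θ (`measureReal_abs_sum_gt_le`) is a truncated Chernoff argument. On the
event that no summand exceeds M, exp(lY) is at most its second-order Taylor bound where Y is small.
Where Y is moderately large, β ≤ 1 bounds it by a small multiple of exp(|Y|^β). Centring removes the
linear term, so the true variance appears with an absolute constant; the factor log(2n) pays for the
tails of n summands.

For uniformity, volume nets on the C(p, k) coordinate subspaces give at most (36p/k)^k test vectors,
and running the fixed-θ bound at level t + k log(36p/k) pays for the union bound. A polarisation
argument (`exists_finset_sSup_quadForm_le`) passes from the net to the supremum at the cost of a
factor 2, so the variance constant is 2 · 3 = 6 ≤ 14.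

The two cases differ only in the scale of the exponential moments. A joint norm bound controls Xᵀθ
directly. Under a marginal bound, Cauchy–Schwarz bounds (Xᵀθ)² by a sum of k squared coordinates,
and Jensen's inequality for a shifted exp(x^β) gives scale k with a constant independent of k
(`expMoment_average`). -/

noncomputable section

namespace SubWeibull

/-! ### Nets of the sparse sphere -/

open Module Metric in
/-- A `1/4`-separated finite set of unit vectors has at most `9 ^ dim` elements. -/
theorem card_le_of_quarter_separated {E : Type*} [NormedAddCommGroup E] [NormedSpace ℝ E]
    [FiniteDimensional ℝ E] (s : Finset E) (hs : ∀ c ∈ s, ‖c‖ = 1)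
    (h : ∀ c ∈ s, ∀ d ∈ s, c ≠ d → 1 / 4 ≤ ‖c - d‖) : s.card ≤ 9 ^ finrank ℝ E := by
  borelize E
  let μ : Measure E := Measure.addHaar
  -- Disjoint balls of radius 1/8 inside the ball of radius 9/8: the volume ratio is 9 to the
  -- dimension.
  set A := ⋃ c ∈ s, ball (c : E) (1 / 8) with hA
  have D : Set.Pairwise (s : Set E) (Function.onFun Disjoint fun c => ball (c : E) (1 / 8)) := by
    rintro c hc d hd hcd
    apply ball_disjoint_ball
    rw [dist_eq_norm]
    linarith [h c hc d hd hcd]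
  have A_subset : A ⊆ ball (0 : E) (9 / 8) := by
    refine Set.iUnion₂_subset fun x hx => ball_subset_ball' ?_
    rw [dist_zero_right, hs x hx]
    norm_num
  have I : (s.card : ℝ≥0∞) * ENNReal.ofReal ((1 / 8) ^ finrank ℝ E) * μ (ball 0 1) ≤
      ENNReal.ofReal ((9 / 8) ^ finrank ℝ E) * μ (ball 0 1) :=
    calc
      _ = μ A := by
        rw [hA, measure_biUnion_finset D fun c _ => measurableSet_ball]
        simp only [μ.addHaar_ball_of_pos _ (show (0 : ℝ) < 1 / 8 by norm_num), Finset.sum_const,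
          nsmul_eq_mul, mul_assoc]
      _ ≤ μ (ball (0 : E) (9 / 8)) := measure_mono A_subset
      _ = _ := by rw [μ.addHaar_ball_of_pos _ (show (0 : ℝ) < 9 / 8 by norm_num)]
  have J : (s.card : ℝ≥0∞) * ENNReal.ofReal ((1 / 8) ^ finrank ℝ E) ≤
      ENNReal.ofReal ((9 / 8) ^ finrank ℝ E) :=
    (ENNReal.mul_le_mul_iff_left (measure_ball_pos _ _ zero_lt_one).ne' measure_ball_lt_top.ne).1 I
  have K : (s.card : ℝ) ≤ (9 : ℝ) ^ finrank ℝ E := by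
    have := ENNReal.toReal_le_of_le_ofReal (by positivity) J
    simpa [div_eq_mul_inv, mul_pow] using this
  exact mod_cast K

/-- The unit sphere of a finite-dimensional normed space has a `1/4`-net with at most `9 ^ dim`
elements. -/
theorem exists_quarter_net (E : Type*) [NormedAddCommGroup E] [NormedSpace ℝ E]
    [FiniteDimensional ℝ E] : ∃ s : Finset E, s.card ≤ 9 ^ Module.finrank ℝ E ∧
      (∀ c ∈ s, ‖c‖ = 1) ∧ ∀ x : E, ‖x‖ = 1 → ∃ c ∈ s, ‖x - c‖ ≤ 1 / 4 := by
  classical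
  by_contra! hcon
  -- Without a net, every separated set can be enlarged greedily, eventually beyond the volume
  -- bound.
  have key : ∀ m : ℕ, ∃ s : Finset E, s.card = m ∧ (∀ c ∈ s, ‖c‖ = 1) ∧
      ∀ c ∈ s, ∀ d ∈ s, c ≠ d → 1 / 4 ≤ ‖c - d‖ := by
    intro m
    induction m with
    | zero => exact ⟨∅, by simp⟩
    | succ m ih =>
      obtain ⟨s, hcard, h1, h2⟩ := ih
      obtain ⟨x, hx, hxs⟩ := hcon s (card_le_of_quarter_separated s h1 h2) h1
      have hxn : x ∉ s := fun hmem => by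
        have := hxs x hmem
        simp at this
        linarith
      refine ⟨insert x s, by rw [Finset.card_insert_of_notMem hxn, hcard], ?_, ?_⟩
      · intro c hc
        rcases Finset.mem_insert.1 hc with rfl | hc
        exacts [hx, h1 c hc]
      · intro c hc d hd hcd
        rcases Finset.mem_insert.1 hc with hc' | hc' <;>
          rcases Finset.mem_insert.1 hd with hd' | hd'
        · exact absurd (hc'.trans hd'.symm) hcd
        · exact hc' ▸ (hxs d hd').le
        · rw [norm_sub_rev]; exact hd' ▸ (hxs c hc').le
        · exact h2 c hc' d hd' hcd
  obtain ⟨s, hcard, h1, h2⟩ := key (9 ^ Module.finrank ℝ E + 1)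
  have := card_le_of_quarter_separated s h1 h2
  omega

/-- `C(p, k) 9 ^ k ≤ (36 p / k) ^ k`. -/
theorem choose_mul_nine_pow_le {p k : ℕ} (hk : 1 ≤ k) :
    (p.choose k : ℝ) * 9 ^ k ≤ (36 * (p : ℝ) / k) ^ k := by
  have hk0 : (0 : ℝ) < k := by exact_mod_cast hk
  have h1 : (p.choose k : ℝ) ≤ (p : ℝ) ^ k / (k.factorial : ℝ) := Nat.choose_le_pow_div k p
  have h2 : (k : ℝ) ^ k / (k.factorial : ℝ) ≤ Real.exp k := Real.pow_div_factorial_le_exp _ hk0.le k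
  -- Rounding e up to 4 produces the constant 36 = 4 · 9.
  have h3 : Real.exp (k : ℝ) ≤ 4 ^ k := by
    rw [← Real.exp_one_pow]
    exact pow_le_pow_left₀ (Real.exp_pos _).le (Real.exp_one_lt_d9.le.trans (by norm_num)) k
  have hf : (0 : ℝ) < k.factorial := by exact_mod_cast k.factorial_pos
  calc (p.choose k : ℝ) * 9 ^ k ≤ (p : ℝ) ^ k / (k.factorial : ℝ) * 9 ^ k := by gcongr
    _ = ((k : ℝ) ^ k / (k.factorial : ℝ)) * (9 * p / k) ^ k := by
        rw [div_pow, mul_pow]; field_simp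
    _ ≤ 4 ^ k * (9 * p / k) ^ k := by gcongr; exact h2.trans h3
    _ = _ := by rw [← mul_pow]; congr 1; ring

theorem l0_le_of_forall {p : ℕ} {θ : EuclideanSpace ℝ (Fin p)} {S : Finset (Fin p)}
    (h : ∀ j, j ∉ S → θ j = 0) : l0 θ ≤ S.card := by
  rw [← Set.ncard_coe_finset]
  refine Set.ncard_le_ncard (fun j hj => ?_) S.finite_toSet
  by_contra hjS
  exact hj (h j hjS)

/-- Since k ≤ p the support can be padded to exactly k indices, so only the C(p, k) sets of that
size need a net. -/
theorem exists_support {p k : ℕ} (hkp : k ≤ p) {θ : EuclideanSpace ℝ (Fin p)} (h : l0 θ ≤ k) :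
    ∃ S : Finset (Fin p), S.card = k ∧ ∀ j, j ∉ S → θ j = 0 := by
  classical
  have hcard : (Finset.univ.filter fun j => θ j ≠ 0).card ≤ k := by
    rw [← Set.ncard_coe_finset]
    simpa [l0] using h
  obtain ⟨S, hS, -, hSk⟩ := Finset.exists_subsuperset_card_eq
    (Finset.subset_univ (Finset.univ.filter fun j => θ j ≠ 0)) hcard (by simpa using hkp)
  refine ⟨S, hSk, fun j hj => ?_⟩
  by_contra hne
  exact hj (hS (by simp [hne]))

/-- The vectors supported in `S`. -/
def supportedIn {p : ℕ} (S : Finset (Fin p)) : Submodule ℝ (EuclideanSpace ℝ (Fin p)) where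
  carrier := {θ | ∀ j, j ∉ S → θ j = 0}
  add_mem' := fun ha hb j hj => by simp [ha j hj, hb j hj]
  zero_mem' := fun _ _ => rfl
  smul_mem' := fun c _ ha j hj => by simp [ha j hj]

theorem finrank_supportedIn_le {p : ℕ} (S : Finset (Fin p)) :
    Module.finrank ℝ (supportedIn S) ≤ S.card := by
  classical
  have hle : supportedIn S ≤ Submodule.span ℝ
      ((S.image fun j => EuclideanSpace.single j (1 : ℝ) : Finset (EuclideanSpace ℝ (Fin p))) :
        Set (EuclideanSpace ℝ (Fin p))) := by
    intro θ hθ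
    have : θ = ∑ j ∈ S, θ j • EuclideanSpace.single j (1 : ℝ) := by
      ext l
      by_cases hl : l ∈ S
      · simp [Finset.sum_apply, Pi.single_apply, hl]
      · simp [Finset.sum_apply, Pi.single_apply, hl, hθ l hl]
    rw [this]
    exact Submodule.sum_mem _ fun j hj => Submodule.smul_mem _ _
      (Submodule.subset_span (Finset.mem_coe.2 (Finset.mem_image_of_mem _ hj)))
  exact (Submodule.finrank_mono hle).trans
    ((finrank_span_finset_le_card _).trans Finset.card_image_le)

/-- A finite `1/4`-net of the sparse sphere that approximates each vector inside its support. -/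
theorem exists_sparse_net {p k : ℕ} (hk : 1 ≤ k) (hkp : k ≤ p) :
    ∃ N : Finset (EuclideanSpace ℝ (Fin p)), (N.card : ℝ) ≤ (36 * (p : ℝ) / k) ^ k ∧
      (∀ c ∈ N, c ∈ sparseSphere p k) ∧
      ∀ θ ∈ sparseSphere p k, ∃ c ∈ N, ‖θ - c‖ ≤ 1 / 4 ∧
        ∀ a b : ℝ, l0 (a • θ + b • c) ≤ k := by
  classical
  choose s hcard hunit hnet using
    fun S : Finset (Fin p) => exists_quarter_net (supportedIn S)
  refine ⟨((Finset.univ : Finset (Fin p)).powersetCard k).biUnion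
    fun S => (s S).image (supportedIn S).subtype, ?_, ?_, ?_⟩
  · refine le_trans ?_ (choose_mul_nine_pow_le hk)
    have : (((Finset.univ : Finset (Fin p)).powersetCard k).biUnion
        fun S => (s S).image (supportedIn S).subtype).card ≤
        ((Finset.univ : Finset (Fin p)).powersetCard k).card * 9 ^ k := by
      refine Finset.card_biUnion_le_card_mul _ _ _ fun S hS => Finset.card_image_le.trans ?_
      refine (hcard S).trans (Nat.pow_le_pow_right (by norm_num) ?_)
      exact (finrank_supportedIn_le S).trans (Finset.mem_powersetCard.1 hS).2.le
    rw [Finset.card_powersetCard, Finset.card_univ, Fintype.card_fin] at this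
    exact_mod_cast this
  · intro c hc
    obtain ⟨S, hS, hc⟩ := Finset.mem_biUnion.1 hc
    obtain ⟨d, hd, rfl⟩ := Finset.mem_image.1 hc
    exact ⟨(l0_le_of_forall d.2).trans (Finset.mem_powersetCard.1 hS).2.le, hunit S d hd⟩
  · rintro θ ⟨h0, h1⟩
    obtain ⟨S, hSk, hS⟩ := exists_support hkp h0
    obtain ⟨d, hd, hdist⟩ := hnet S ⟨θ, hS⟩ h1
    refine ⟨d, Finset.mem_biUnion.2 ⟨S, Finset.mem_powersetCard.2 ⟨Finset.subset_univ _, hSk⟩,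
      Finset.mem_image_of_mem _ hd⟩, hdist, fun a b => ?_⟩
    exact hSk ▸ l0_le_of_forall (Submodule.add_mem _
      (Submodule.smul_mem _ a (show θ ∈ supportedIn S from hS)) (Submodule.smul_mem _ b d.2))

/-! ### From the net to the supremum of a quadratic form -/

/-- The quadratic form of a matrix. -/
def quadForm {p : ℕ} (A : Matrix (Fin p) (Fin p) ℝ) (θ : EuclideanSpace ℝ (Fin p)) : ℝ :=
  dotProduct θ.ofLp (A.mulVec θ.ofLp)

theorem quadForm_add_smul {p : ℕ} (A : Matrix (Fin p) (Fin p) ℝ) (x y : EuclideanSpace ℝ (Fin p))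
    (a b : ℝ) : quadForm A (a • x + b • y) = a ^ 2 * quadForm A x + b ^ 2 * quadForm A y +
      a * b * (dotProduct x.ofLp (A.mulVec y.ofLp) + dotProduct y.ofLp (A.mulVec x.ofLp)) := by
  simp only [quadForm, WithLp.ofLp_add, WithLp.ofLp_smul, Matrix.mulVec_add, Matrix.mulVec_smul,
    add_dotProduct, dotProduct_add, smul_dotProduct, dotProduct_smul, smul_eq_mul]
  ring

theorem quadForm_smul {p : ℕ} (A : Matrix (Fin p) (Fin p) ℝ) (x : EuclideanSpace ℝ (Fin p))
    (a : ℝ) : quadForm A (a • x) = a ^ 2 * quadForm A x := by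
  simpa using quadForm_add_smul A x 0 a 0

theorem bddAbove_abs_quadForm {p : ℕ} (A : Matrix (Fin p) (Fin p) ℝ)
    (s : Set (EuclideanSpace ℝ (Fin p))) (hs : ∀ θ ∈ s, ‖θ‖ ≤ 1) :
    BddAbove ((fun θ => |quadForm A θ|) '' s) := by
  have hcont : Continuous fun θ : EuclideanSpace ℝ (Fin p) => |quadForm A θ| := by
    unfold quadForm Matrix.mulVec dotProduct
    fun_prop
  refine ((isCompact_closedBall (0 : EuclideanSpace ℝ (Fin p)) 1).bddAbove_image
    hcont.continuousOn).mono (Set.image_mono fun θ hθ => ?_)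
  simpa using hs θ hθ

/-- Discretisation: the supremum of a quadratic form over sparse vectors of the unit ball is at most
twice its maximum over a finite set of at most `(36 p / k) ^ k` sparse unit vectors. -/
theorem exists_finset_sSup_quadForm_le {p k : ℕ} (hk : 1 ≤ k) (hkp : k ≤ p) :
    ∃ N : Finset (EuclideanSpace ℝ (Fin p)), (N.card : ℝ) ≤ (36 * (p : ℝ) / k) ^ k ∧
      (∀ c ∈ N, c ∈ sparseSphere p k) ∧
      ∀ (A : Matrix (Fin p) (Fin p) ℝ) (b : ℝ), 0 ≤ b → (∀ c ∈ N, |quadForm A c| ≤ b) →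
        sSup ((fun θ => |quadForm A θ|) ''
          {θ : EuclideanSpace ℝ (Fin p) | l0 θ ≤ k ∧ ‖θ‖ ≤ 1}) ≤ 2 * b := by
  obtain ⟨N, hcard, hN, hnet⟩ := exists_sparse_net hk hkp
  refine ⟨N, hcard, hN, fun A b hb hbN => ?_⟩
  set T := (fun θ => |quadForm A θ|) '' {θ : EuclideanSpace ℝ (Fin p) | l0 θ ≤ k ∧ ‖θ‖ ≤ 1}
  have hbdd : BddAbove T := bddAbove_abs_quadForm A _ fun θ hθ => hθ.2
  have hB0 : 0 ≤ sSup T := by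
    refine Real.sSup_nonneg fun x hx => ?_
    obtain ⟨θ, -, rfl⟩ := hx
    exact abs_nonneg _
  have hl0 : ∀ (a : ℝ) (u : EuclideanSpace ℝ (Fin p)), l0 u ≤ k → l0 (a • u) ≤ k := by
    refine fun a u hu => le_trans (Set.ncard_le_ncard (fun j hj => ?_) (Set.toFinite _)) hu
    exact fun h => hj (by simp [h])
  have hquad : ∀ u : EuclideanSpace ℝ (Fin p), l0 u ≤ k → |quadForm A u| ≤ sSup T * ‖u‖ ^ 2 := by
    intro u hu
    rcases eq_or_ne u 0 with rfl | hu0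
    · simp [quadForm]
    have hn : 0 < ‖u‖ := norm_pos_iff.2 hu0
    have h1 : |quadForm A (‖u‖⁻¹ • u)| ≤ sSup T :=
      le_csSup hbdd ⟨_, ⟨hl0 _ _ hu, by rw [norm_smul]; simp [hn.ne']⟩, rfl⟩
    rw [quadForm_smul, abs_mul, abs_of_nonneg (by positivity), inv_pow, inv_mul_eq_div,
      div_le_iff₀ (by positivity)] at h1
    exact h1
  have hsphere : ∀ θ ∈ sparseSphere p k, |quadForm A θ| ≤ b + sSup T / 2 := by
    intro θ hθ
    obtain ⟨c, hc, hdist, hsp⟩ := hnet θ hθ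
    have hc1 := (hN c hc).2
    -- Write Q for the form. In Q(9θ - 7c) - Q(7θ - 9c) the cross terms cancel, leaving 32 (Q(θ) -
    -- Q(c)); symmetry of the matrix is not needed, and both arguments stay k-sparse.
    have e1 := quadForm_add_smul A θ c 9 (-7)
    have e2 := quadForm_add_smul A θ c 7 (-9)
    have i1 := abs_le.1 (hquad _ (hsp 9 (-7)))
    have i2 := abs_le.1 (hquad _ (hsp 7 (-9)))
    -- The two vectors are 8(θ - c) ± (θ + c). The weight 8 makes both parts have norm at most 2,
    -- and 16/32 gives the contraction factor 1/2.
    have n1 : ‖(9 : ℝ) • θ + (-7 : ℝ) • c‖ ^ 2 + ‖(7 : ℝ) • θ + (-9 : ℝ) • c‖ ^ 2 ≤ 16 := by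
      have e := parallelogram_law_with_norm ℝ ((8 : ℝ) • (θ - c)) (θ + c)
      have e3 : (8 : ℝ) • (θ - c) + (θ + c) = (9 : ℝ) • θ + (-7 : ℝ) • c := by module
      have e4 : (8 : ℝ) • (θ - c) - (θ + c) = (7 : ℝ) • θ + (-9 : ℝ) • c := by module
      have h2 : ‖θ + c‖ ≤ 2 := (norm_add_le _ _).trans (by rw [hθ.2, hc1]; norm_num)
      have h3 : ‖(8 : ℝ) • (θ - c)‖ ≤ 2 := by
        rw [norm_smul]; norm_num; linarith
      rw [e3, e4] at e
      nlinarith [norm_nonneg (θ + c), norm_nonneg ((8 : ℝ) • (θ - c))]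
    have h4 := mul_le_mul_of_nonneg_left n1 hB0
    have h5 := abs_le.1 (hbN c hc)
    rw [abs_le]
    constructor <;> linarith [i1.1, i1.2, i2.1, i2.2, h5.1, h5.2]
  have hall : sSup T ≤ b + sSup T / 2 := by
    refine Real.sSup_le ?_ (by positivity)
    rintro _ ⟨θ, ⟨h0, h1⟩, rfl⟩
    rcases eq_or_ne θ 0 with rfl | hne
    · simp only [quadForm, WithLp.ofLp_zero, Matrix.mulVec_zero, dotProduct_zero, abs_zero]
      positivity
    have hn : 0 < ‖θ‖ := norm_pos_iff.2 hne
    have h2 := hsphere (‖θ‖⁻¹ • θ) ⟨hl0 _ _ h0, by rw [norm_smul]; simp [hn.ne']⟩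
    rw [quadForm_smul, abs_mul, abs_of_nonneg (by positivity), inv_pow, inv_mul_eq_div,
      div_le_iff₀ (by positivity)] at h2
    refine h2.trans (mul_le_of_le_one_right (by positivity) (pow_le_one₀ hn.le h1))
  linarith

/-! ### Truncated Chernoff bound for sub-Weibull sums -/

/-- The exponential moment bound `E exp((|W| / L) ^ β) ≤ D`. -/
def ExpMoment {Ω : Type*} [MeasurableSpace Ω] (μ : Measure Ω) (β L D : ℝ) (W : Ω → ℝ) : Prop :=
  Integrable (fun ω => Real.exp ((|W ω| / L) ^ β)) μ ∧ ∫ ω, Real.exp ((|W ω| / L) ^ β) ∂μ ≤ D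

/-- The function `y ↦ exp(l y) 1{|y| ≤ M}`. -/
def truncExp (l M y : ℝ) : ℝ := if |y| ≤ M then Real.exp (l * y) else 0

theorem measurable_truncExp (l M : ℝ) : Measurable (truncExp l M) :=
  Measurable.ite (measurableSet_le (by fun_prop) measurable_const) (by fun_prop) measurable_const

theorem truncExp_nonneg (l M y : ℝ) : 0 ≤ truncExp l M y := by
  unfold truncExp
  split_ifs
  exacts [(Real.exp_pos _).le, le_rfl]

theorem truncExp_le_exp {l M : ℝ} (hl : 0 ≤ l) (y : ℝ) : truncExp l M y ≤ Real.exp (l * M) := by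
  unfold truncExp
  split_ifs with h
  · exact Real.exp_le_exp.2 (mul_le_mul_of_nonneg_left ((le_abs_self y).trans h) hl)
  · exact (Real.exp_pos _).le

/-- Up to M₀ the exponent is at most 1 in modulus and the quadratic Taylor bound applies. Between M₀
and M, concavity of the power gives l|y| ≤ |y|^β / 2, which leaves a spare factor exp(-M₀^β / 2).
Beyond M the left side vanishes. -/
theorem truncExp_le {β l M M₀ : ℝ} (hβ0 : 0 < β) (hβ1 : β ≤ 1) (hl : 0 ≤ l) (hM : 0 < M)
    (hM₀ : 0 ≤ M₀) (h1 : l * M₀ ≤ 1) (h2 : l * M ≤ M ^ β / 2) (y : ℝ) :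
    truncExp l M y ≤ 1 + l * y + l ^ 2 * y ^ 2 + Real.exp (|y| ^ β - M₀ ^ β / 2) := by
  have hpos : 0 ≤ 1 + l * y + l ^ 2 * y ^ 2 := by nlinarith [sq_nonneg (l * y + 1), sq_nonneg (l * y)]
  have hexp := Real.exp_pos (|y| ^ β - M₀ ^ β / 2)
  unfold truncExp
  split_ifs with h
  · rcases le_or_gt |y| M₀ with hy | hy
    · have h3 : |l * y| ≤ 1 := by
        rw [abs_mul, abs_of_nonneg hl]
        exact (mul_le_mul_of_nonneg_left hy hl).trans h1
      have h4 := (abs_le.1 (Real.abs_exp_sub_one_sub_id_le h3)).2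
      nlinarith
    · have h3 : l * |y| ≤ |y| ^ β / 2 := by
        set r := |y| / M with hr
        have hr0 : 0 ≤ r := by positivity
        have hr1 : r ≤ 1 := (div_le_one hM).2 h
        have hy' : |y| = M * r := by rw [hr]; field_simp
        -- This is where β ≤ 1 enters: the linear function lies below the power on [0, 1], so the
        -- bound at M extends to all smaller |y|.
        have hrr : r ≤ r ^ β := by
          rcases hr0.eq_or_lt with h0 | h0
          · rw [← h0, Real.zero_rpow hβ0.ne']
          · simpa using Real.rpow_le_rpow_of_exponent_ge h0 hr1 hβ1
        rw [hy', Real.mul_rpow hM.le hr0]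
        have : 0 ≤ M ^ β := by positivity
        calc l * (M * r) = (l * M) * r := by ring
          _ ≤ M ^ β / 2 * r := by gcongr
          _ ≤ M ^ β / 2 * r ^ β := by gcongr
          _ = _ := by ring
      have h4 : M₀ ^ β ≤ |y| ^ β := Real.rpow_le_rpow hM₀ hy.le hβ0.le
      have h5 : l * y ≤ |y| ^ β - M₀ ^ β / 2 := by
        have := mul_le_mul_of_nonneg_left (le_abs_self y) hl
        linarith
      have := Real.exp_le_exp.2 h5
      linarith
  · linarith

/-- The linear term has mean zero for the untruncated variable, so truncation leaves no bias; then 1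
+ x ≤ exp x. -/
theorem integral_truncExp_le {Ω : Type*} [MeasurableSpace Ω] {μ : Measure Ω}
    [IsProbabilityMeasure μ] {β l M M₀ D : ℝ} (hβ0 : 0 < β) (hβ1 : β ≤ 1) (hl : 0 ≤ l) (hM : 0 < M)
    (hM₀ : 0 ≤ M₀) (h1 : l * M₀ ≤ 1) (h2 : l * M ≤ M ^ β / 2) {Y : Ω → ℝ} (hY : Measurable Y)
    (hY1 : Integrable Y μ) (hY2 : Integrable (fun ω => Y ω ^ 2) μ) (hmean : ∫ ω, Y ω ∂μ = 0)
    (hexp : ExpMoment μ β 1 D Y) :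
    ∫ ω, truncExp l M (Y ω) ∂μ ≤
      Real.exp (l ^ 2 * ∫ ω, Y ω ^ 2 ∂μ + D * Real.exp (-(M₀ ^ β / 2))) := by
  have hi : Integrable (fun ω => truncExp l M (Y ω)) μ := by
    refine Integrable.of_bound ((measurable_truncExp l M).comp hY).aestronglyMeasurable
      (Real.exp (l * M)) (Filter.Eventually.of_forall fun ω => ?_)
    rw [Real.norm_of_nonneg (truncExp_nonneg _ _ _)]
    exact truncExp_le_exp hl _
  obtain ⟨he1, he2⟩ := hexp
  simp only [div_one] at he1 he2
  have hE : ∀ ω, Real.exp (|Y ω| ^ β - M₀ ^ β / 2) =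
      Real.exp (|Y ω| ^ β) * Real.exp (-(M₀ ^ β / 2)) := fun ω => by
    rw [← Real.exp_add, sub_eq_add_neg]
  have hle : ∫ ω, truncExp l M (Y ω) ∂μ ≤ ∫ ω, (1 + l * Y ω + l ^ 2 * Y ω ^ 2 +
      Real.exp (|Y ω| ^ β) * Real.exp (-(M₀ ^ β / 2))) ∂μ := by
    refine integral_mono hi ?_ fun ω => ?_
    · exact (((integrable_const _).add (hY1.const_mul _)).add (hY2.const_mul _)).add
        (he1.mul_const _)
    · rw [← hE]
      exact truncExp_le hβ0 hβ1 hl hM hM₀ h1 h2 (Y ω)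
  have heq : ∫ ω, (1 + l * Y ω + l ^ 2 * Y ω ^ 2 +
      Real.exp (|Y ω| ^ β) * Real.exp (-(M₀ ^ β / 2))) ∂μ =
      1 + l ^ 2 * ∫ ω, Y ω ^ 2 ∂μ + (∫ ω, Real.exp (|Y ω| ^ β) ∂μ) * Real.exp (-(M₀ ^ β / 2)) := by
    have i1 : Integrable (fun ω => 1 + l * Y ω) μ := (integrable_const _).add (hY1.const_mul _)
    have i2 : Integrable (fun ω => 1 + l * Y ω + l ^ 2 * Y ω ^ 2) μ := i1.add (hY2.const_mul _)
    rw [integral_add i2 (he1.mul_const _), integral_add i1 (hY2.const_mul _),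
      integral_add (integrable_const _) (hY1.const_mul _),
      integral_const_mul, integral_const_mul, integral_mul_const, hmean]
    simp
  have h3 := mul_le_mul_of_nonneg_right he2 (Real.exp_pos (-(M₀ ^ β / 2))).le
  have h4 := Real.add_one_le_exp (l ^ 2 * ∫ ω, Y ω ^ 2 ∂μ + D * Real.exp (-(M₀ ^ β / 2)))
  linarith

/-- Chernoff bound for a sum of independent variables on the event that no summand is large. -/
theorem measureReal_sum_gt_and_forall_le {Ω : Type*} [MeasurableSpace Ω] {μ : Measure Ω}
    [IsProbabilityMeasure μ] {β l M M₀ D : ℝ} (hβ0 : 0 < β) (hβ1 : β ≤ 1) (hl : 0 ≤ l) (hM : 0 < M)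
    (hM₀ : 0 ≤ M₀) (h1 : l * M₀ ≤ 1) (h2 : l * M ≤ M ^ β / 2) {n : ℕ} {Y : Fin n → Ω → ℝ}
    (hY : ∀ i, Measurable (Y i)) (hind : iIndepFun Y μ)
    (hY1 : ∀ i, Integrable (Y i) μ) (hY2 : ∀ i, Integrable (fun ω => Y i ω ^ 2) μ)
    (hmean : ∀ i, ∫ ω, Y i ω ∂μ = 0) (hexp : ∀ i, ExpMoment μ β 1 D (Y i)) (s : ℝ) :
    μ.real {ω | s < ∑ i, Y i ω ∧ ∀ i, |Y i ω| ≤ M} ≤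
      Real.exp (-(l * s) + l ^ 2 * ∑ i, ∫ ω, Y i ω ^ 2 ∂μ +
        n * (D * Real.exp (-(M₀ ^ β / 2)))) := by
  have hmeas : Measurable fun ω => ∏ i, truncExp l M (Y i ω) :=
    Finset.measurable_fun_prod _ fun i _ => (measurable_truncExp l M).comp (hY i)
  have h0 : ∀ ω, 0 ≤ ∏ i, truncExp l M (Y i ω) := fun ω =>
    Finset.prod_nonneg fun i _ => truncExp_nonneg _ _ _
  have hint : Integrable (fun ω => ∏ i, truncExp l M (Y i ω)) μ := by
    refine Integrable.of_bound hmeas.aestronglyMeasurable (∏ _i : Fin n, Real.exp (l * M))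
      (Filter.Eventually.of_forall fun ω => ?_)
    rw [Real.norm_of_nonneg (h0 ω)]
    exact Finset.prod_le_prod (fun i _ => truncExp_nonneg _ _ _) fun i _ => truncExp_le_exp hl _
  have hmarkov := mul_meas_ge_le_integral_of_nonneg (Filter.Eventually.of_forall h0) hint
    (Real.exp (l * s))
  have hprod : ∫ ω, ∏ i, truncExp l M (Y i ω) ∂μ = ∏ i, ∫ ω, truncExp l M (Y i ω) ∂μ :=
    hind.integral_fun_prod_comp (f := fun _ => truncExp l M) (fun i => (hY i).aemeasurable)
      fun i => (measurable_truncExp l M).aestronglyMeasurable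
  have hbound : ∫ ω, ∏ i, truncExp l M (Y i ω) ∂μ ≤
      Real.exp (l ^ 2 * ∑ i, ∫ ω, Y i ω ^ 2 ∂μ + n * (D * Real.exp (-(M₀ ^ β / 2)))) := by
    rw [hprod]
    calc _ ≤ ∏ i, Real.exp (l ^ 2 * ∫ ω, Y i ω ^ 2 ∂μ + D * Real.exp (-(M₀ ^ β / 2))) :=
          Finset.prod_le_prod (fun i _ => integral_nonneg fun ω => truncExp_nonneg _ _ _) fun i _ =>
            integral_truncExp_le hβ0 hβ1 hl hM hM₀ h1 h2 (hY i) (hY1 i) (hY2 i) (hmean i) (hexp i)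
      _ = _ := by
          rw [← Real.exp_sum, Finset.sum_add_distrib, ← Finset.mul_sum]
          simp
  have hsub : μ.real {ω | s < ∑ i, Y i ω ∧ ∀ i, |Y i ω| ≤ M} ≤
      μ.real {ω | Real.exp (l * s) ≤ ∏ i, truncExp l M (Y i ω)} := by
    refine measureReal_mono fun ω hω => ?_
    have : ∏ i, truncExp l M (Y i ω) = Real.exp (l * ∑ i, Y i ω) := by
      rw [Finset.mul_sum, Real.exp_sum]
      exact Finset.prod_congr rfl fun i _ => if_pos (hω.2 i)
    rw [Set.mem_ofPred_eq, this]
    exact Real.exp_le_exp.2 (mul_le_mul_of_nonneg_left hω.1.le hl)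
  refine hsub.trans ?_
  have h5 : μ.real {ω | Real.exp (l * s) ≤ ∏ i, truncExp l M (Y i ω)} ≤
      Real.exp (l ^ 2 * ∑ i, ∫ ω, Y i ω ^ 2 ∂μ + n * (D * Real.exp (-(M₀ ^ β / 2)))) /
        Real.exp (l * s) := by
    rw [le_div_iff₀ (Real.exp_pos _), mul_comm]
    exact hmarkov.trans hbound
  rw [← Real.exp_sub] at h5
  refine h5.trans_eq ?_
  congr 1
  ring

theorem ExpMoment.measureReal_gt_le {Ω : Type*} [MeasurableSpace Ω] {μ : Measure Ω}
    [IsProbabilityMeasure μ] {β D M : ℝ} (hβ0 : 0 < β) (hM : 0 ≤ M) {Y : Ω → ℝ}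
    (hexp : ExpMoment μ β 1 D Y) : μ.real {ω | M < |Y ω|} ≤ D * Real.exp (-M ^ β) := by
  have h := mul_meas_ge_le_integral_of_nonneg
    (Filter.Eventually.of_forall fun ω => (Real.exp_pos _).le) hexp.1 (Real.exp (M ^ β))
  have hsub : μ.real {ω | M < |Y ω|} ≤
      μ.real {ω | Real.exp (M ^ β) ≤ Real.exp ((|Y ω| / 1) ^ β)} := by
    refine measureReal_mono fun ω hω => ?_
    simp only [Set.mem_ofPred_eq, div_one] at hω ⊢
    exact Real.exp_le_exp.2 (Real.rpow_le_rpow hM hω.le hβ0.le)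
  rw [Real.exp_neg, ← div_eq_mul_inv, le_div_iff₀ (Real.exp_pos _)]
  nlinarith [h.trans hexp.2, Real.exp_pos (M ^ β)]

/-- Choice of the Chernoff parameter. -/
theorem exists_chernoff_parameter {V τ lmax : ℝ} (hV : 0 ≤ V) (hτ : 1 ≤ τ) (hl : 0 < lmax) :
    ∃ l, 0 ≤ l ∧ l ≤ lmax ∧
      -(l * (3 * √(V * τ) + 3 * (τ / lmax))) + l ^ 2 * V + 1 / 2 ≤ -τ := by
  -- Take the smaller of the cap and √(τ/V). Either way the linear part supplies 3τ, the quadratic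
  -- part costs at most τ, and τ ≥ 1 absorbs the 1/2.
  rcases le_or_gt (lmax ^ 2 * V) τ with h | h
  · refine ⟨lmax, hl.le, le_rfl, ?_⟩
    have h1 : lmax * (3 * (τ / lmax)) = 3 * τ := by field_simp
    have h2 : 0 ≤ lmax * (3 * √(V * τ)) := by positivity
    nlinarith
  · have hV0 : 0 < V := by
      rcases hV.eq_or_lt with h0 | h0
      · rw [← h0] at h; linarith
      · exact h0
    have hsq : √(τ / V) ^ 2 = τ / V := Real.sq_sqrt (by positivity)
    refine ⟨√(τ / V), Real.sqrt_nonneg _, ?_, ?_⟩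
    · rw [Real.sqrt_le_left hl.le, div_le_iff₀ hV0]
      exact h.le
    · have h1 : √(τ / V) * √(V * τ) = τ := by
        rw [← Real.sqrt_mul (by positivity), show τ / V * (V * τ) = τ * τ by field_simp,
          Real.sqrt_mul_self (by linarith)]
      have h2 : √(τ / V) ^ 2 * V = τ := by rw [hsq]; field_simp
      have h3 : 0 ≤ √(τ / V) * (3 * (τ / lmax)) := by positivity
      rw [h2, mul_add, ← mul_assoc, mul_comm _ (3 : ℝ), mul_assoc, h1]
      linarith

/-- Concentration of a sum of independent centred sub-Weibull variables with a sharp variance term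
and the factor `log (2 n)` in the heavy-tail term. -/
theorem measureReal_abs_sum_gt_le {Ω : Type*} [MeasurableSpace Ω] {μ : Measure Ω}
    [IsProbabilityMeasure μ] {β D τ : ℝ} (hβ0 : 0 < β) (hβ1 : β ≤ 1) (hD : 1 ≤ D) (hτ : 1 ≤ τ)
    {n : ℕ} (hn : 1 ≤ n) {Y : Fin n → Ω → ℝ} (hY : ∀ i, Measurable (Y i)) (hind : iIndepFun Y μ)
    (hY1 : ∀ i, Integrable (Y i) μ) (hY2 : ∀ i, Integrable (fun ω => Y i ω ^ 2) μ)
    (hmean : ∀ i, ∫ ω, Y i ω ∂μ = 0) (hexp : ∀ i, ExpMoment μ β 1 D (Y i)) :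
    μ.real {ω | 3 * √((∑ i, ∫ ω, Y i ω ^ 2 ∂μ) * τ) +
        12 * ((4 + 4 * Real.log D) * (Real.log (2 * n) * τ)) ^ (1 / β) < |∑ i, Y i ω|} ≤
      3 * Real.exp (-τ) := by
  set V := ∑ i, ∫ ω, Y i ω ^ 2 ∂μ with hVdef
  have hV : 0 ≤ V := Finset.sum_nonneg fun i _ => integral_nonneg fun ω => sq_nonneg _
  have hn' : (1 : ℝ) ≤ n := by exact_mod_cast hn
  set ℓ := Real.log (2 * n) with hℓdef
  have hexpℓ : Real.exp ℓ = 2 * n := Real.exp_log (by positivity)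
  have hℓ : 1 / 2 ≤ ℓ := by
    have := Real.log_le_log (by norm_num) (show (2 : ℝ) ≤ 2 * n by linarith)
    linarith [Real.log_two_gt_d9]
  have hLD : 0 ≤ Real.log D := Real.log_nonneg hD
  have hexpD : Real.exp (Real.log D) = D := Real.exp_log (by linarith)
  -- With ℓ ≥ 1/2 and τ ≥ 1, this G makes Gℓ/2 ≥ ℓ + log D and Gℓτ ≥ τ + ℓ + log D, which absorbs
  -- both n and D in `c3` and `c4`.
  set G := 4 + 4 * Real.log D with hG
  have hG4 : 4 ≤ G := by linarith
  set Q := G * (ℓ * τ) with hQ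
  have hQpos : 0 < Q := by positivity
  set M := Q ^ (1 / β) with hM
  have hMpos : 0 < M := by positivity
  -- The Taylor cutoff omits τ. As 1/β ≥ 1, M₀τ ≤ M, so an l of order τ/M still satisfies l M₀ ≤ 1.
  set M₀ := (G * ℓ) ^ (1 / β) with hM₀
  have hM₀pos : 0 < M₀ := by positivity
  have hMβ : M ^ β = Q := by
    rw [hM, ← Real.rpow_mul hQpos.le, one_div_mul_cancel hβ0.ne', Real.rpow_one]
  have hM₀β : M₀ ^ β = G * ℓ := by
    rw [hM₀, ← Real.rpow_mul (by positivity), one_div_mul_cancel hβ0.ne', Real.rpow_one]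
  have hMM₀ : M₀ * τ ≤ M := by
    have h1 : τ ≤ τ ^ (1 / β) := by
      simpa using Real.rpow_le_rpow_of_exponent_le hτ ((one_le_div hβ0).2 hβ1)
    rw [hM, hQ, ← mul_assoc, Real.mul_rpow (by positivity) (by positivity)]
    gcongr
  set lmax := τ / (4 * M) with hlmax
  have hlmax0 : 0 < lmax := by positivity
  obtain ⟨l, hl0, hl1, hl2⟩ := exists_chernoff_parameter hV hτ hlmax0
  have hs : 3 * √(V * τ) + 3 * (τ / lmax) = 3 * √(V * τ) + 12 * M := by
    rw [hlmax]; field_simp; ring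
  rw [hs] at hl2
  set s := 3 * √(V * τ) + 12 * M with hsdef
  have c1 : l * M₀ ≤ 1 := by
    calc l * M₀ ≤ lmax * M₀ := by gcongr
      _ = M₀ * τ / (4 * M) := by rw [hlmax]; ring
      _ ≤ 1 := by rw [div_le_one (by positivity)]; linarith
  have c2 : l * M ≤ M ^ β / 2 := by
    calc l * M ≤ lmax * M := by gcongr
      _ = τ / 4 := by rw [hlmax]; field_simp
      _ ≤ M ^ β / 2 := by rw [hMβ, hQ]; nlinarith [mul_le_mul hG4 hℓ (by norm_num) (by linarith)]
  have c3 : n * (D * Real.exp (-(M₀ ^ β / 2))) ≤ 1 / 2 := by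
    have h1 : Real.exp (-(M₀ ^ β / 2)) ≤ Real.exp (-(ℓ + Real.log D)) := by
      rw [Real.exp_le_exp, hM₀β, hG]
      nlinarith
    rw [neg_add, Real.exp_add, Real.exp_neg ℓ, Real.exp_neg (Real.log D), hexpℓ, hexpD] at h1
    have hD0 : 0 < D := by linarith
    calc n * (D * Real.exp (-(M₀ ^ β / 2))) ≤ n * (D * ((2 * (n : ℝ))⁻¹ * D⁻¹)) := by gcongr
      _ = 1 / 2 := by field_simp
  have c4 : D * Real.exp (-M ^ β) ≤ Real.exp (-τ) / (2 * n) := by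
    have h1 : Real.exp (-M ^ β) ≤ Real.exp (-τ + (-ℓ + -Real.log D)) := by
      rw [Real.exp_le_exp, hMβ, hQ, hG]
      have : (1 : ℝ) / 2 ≤ ℓ * τ := by nlinarith
      nlinarith [mul_nonneg hLD (sub_nonneg.2 this)]
    rw [Real.exp_add, Real.exp_add, Real.exp_neg ℓ, Real.exp_neg (Real.log D), hexpℓ, hexpD] at h1
    have hD0 : 0 < D := by linarith
    calc D * Real.exp (-M ^ β) ≤ D * (Real.exp (-τ) * ((2 * (n : ℝ))⁻¹ * D⁻¹)) := by gcongr
      _ = _ := by field_simp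
  have bound : ∀ Z : Fin n → Ω → ℝ, (∀ i, Measurable (Z i)) → iIndepFun Z μ →
      (∀ i, Integrable (Z i) μ) → (∀ i, Integrable (fun ω => Z i ω ^ 2) μ) →
      (∀ i, ∫ ω, Z i ω ∂μ = 0) → (∀ i, ExpMoment μ β 1 D (Z i)) →
      ∑ i, ∫ ω, Z i ω ^ 2 ∂μ = V →
      μ.real {ω | s < ∑ i, Z i ω ∧ ∀ i, |Z i ω| ≤ M} ≤ Real.exp (-τ) := by
    intro Z z1 z2 z3 z4 z5 z6 hZV
    refine (measureReal_sum_gt_and_forall_le hβ0 hβ1 hl0 hMpos hM₀pos.le c1 c2 z1 z2 z3 z4 z5 z6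
      s).trans (Real.exp_le_exp.2 ?_)
    rw [hZV]
    linarith
  have b1 := bound Y hY hind hY1 hY2 hmean hexp rfl
  have b2 := bound (fun i ω => -Y i ω) (fun i => (hY i).neg)
    (hind.comp (fun _ y => -y) fun _ => measurable_neg) (fun i => (hY1 i).neg)
    (fun i => by simpa using hY2 i) (fun i => by rw [integral_neg, hmean i, neg_zero])
    (fun i => by simpa [ExpMoment] using hexp i) (by simp [hVdef])
  have b3 : μ.real (⋃ i, {ω | M < |Y i ω|}) ≤ Real.exp (-τ) := by
    refine (measureReal_iUnion_fintype_le _).trans ?_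
    calc ∑ i, μ.real {ω | M < |Y i ω|} ≤ ∑ _i : Fin n, Real.exp (-τ) / (2 * n) :=
          Finset.sum_le_sum fun i _ => ((hexp i).measureReal_gt_le hβ0 hMpos.le).trans c4
      _ = Real.exp (-τ) / 2 := by
          rw [Finset.sum_const, Finset.card_univ, Fintype.card_fin, nsmul_eq_mul]
          field_simp
      _ ≤ _ := by linarith [Real.exp_pos (-τ)]
  -- Upper tail, lower tail and a large summand each cost at most exp(-τ), whence the factor 3.
  have hsub : {ω | s < |∑ i, Y i ω|} ⊆ ({ω | s < ∑ i, Y i ω ∧ ∀ i, |Y i ω| ≤ M} ∪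
      {ω | s < ∑ i, -Y i ω ∧ ∀ i, |-Y i ω| ≤ M}) ∪ ⋃ i, {ω | M < |Y i ω|} := by
    intro ω hω
    replace hω : s < |∑ i, Y i ω| := hω
    by_cases h : ∀ i, |Y i ω| ≤ M
    · left
      rcases lt_abs.1 hω with h1 | h1
      · exact Or.inl ⟨h1, h⟩
      · exact Or.inr ⟨by rwa [Finset.sum_neg_distrib], fun i => by rw [abs_neg]; exact h i⟩
    · right
      push Not at h
      simpa using h
  have u1 := measureReal_mono hsub (μ := μ)
  have u2 := measureReal_union_le (μ := μ) ({ω | s < ∑ i, Y i ω ∧ ∀ i, |Y i ω| ≤ M} ∪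
      {ω | s < ∑ i, -Y i ω ∧ ∀ i, |-Y i ω| ≤ M}) (⋃ i, {ω | M < |Y i ω|})
  have u3 := measureReal_union_le (μ := μ) {ω | s < ∑ i, Y i ω ∧ ∀ i, |Y i ω| ≤ M}
      {ω | s < ∑ i, -Y i ω ∧ ∀ i, |-Y i ω| ≤ M}
  linarith

/-! ### Exponential moments and Orlicz norms -/

theorem exists_pow_le_mul_exp_rpow {β : ℝ} (hβ0 : 0 < β) (m : ℕ) :
    ∃ c : ℝ, 0 ≤ c ∧ ∀ x : ℝ, 0 ≤ x → x ^ m ≤ c * Real.exp (x ^ β) := by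
  refine ⟨1 + (⌈m / β⌉₊.factorial : ℝ), by positivity, fun x hx => ?_⟩
  have hexp : 1 ≤ Real.exp (x ^ β) := Real.one_le_exp (by positivity)
  have hf : (0 : ℝ) < (⌈m / β⌉₊.factorial : ℝ) := by exact_mod_cast Nat.factorial_pos _
  rcases le_or_gt x 1 with h | h
  · have := pow_le_one₀ hx h (n := m)
    nlinarith
  · have h1 : x ^ m ≤ (x ^ β) ^ ⌈m / β⌉₊ := by
      rw [← Real.rpow_natCast x, ← Real.rpow_natCast, ← Real.rpow_mul hx]
      refine Real.rpow_le_rpow_of_exponent_le h.le ?_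
      have := Nat.le_ceil ((m : ℝ) / β)
      rwa [div_le_iff₀ hβ0, mul_comm] at this
    have h2 := Real.pow_div_factorial_le_exp (x ^ β) (by positivity) ⌈m / β⌉₊
    rw [div_le_iff₀ hf] at h2
    nlinarith

section
variable {Ω : Type*} [MeasurableSpace Ω] {μ : Measure Ω}

theorem ExpMoment.integrable_pow {β L D : ℝ} (hβ0 : 0 < β) (hL : 0 < L) {W : Ω → ℝ}
    (hW : Measurable W) (h : ExpMoment μ β L D W) (m : ℕ) : Integrable (fun ω => |W ω| ^ m) μ := by
  obtain ⟨c, hc, hle⟩ := exists_pow_le_mul_exp_rpow hβ0 m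
  refine (h.1.const_mul (c * L ^ m)).mono'
      (Measurable.aestronglyMeasurable (by fun_prop))
      (Filter.Eventually.of_forall fun ω => ?_)
  have h1 := hle (|W ω| / L) (by positivity)
  rw [div_pow, div_le_iff₀ (by positivity)] at h1
  rw [Real.norm_of_nonneg (by positivity)]
  linarith

theorem ExpMoment.integrable {β L D : ℝ} (hβ0 : 0 < β) (hL : 0 < L) {W : Ω → ℝ}
    (hW : Measurable W) (h : ExpMoment μ β L D W) : Integrable W μ := by
  rw [← integrable_norm_iff hW.aestronglyMeasurable]
  simpa using h.integrable_pow hβ0 hL hW 1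

theorem ExpMoment.of_le {β L L' D : ℝ} (hβ0 : 0 < β) {W W' : Ω → ℝ} (hW' : Measurable W')
    (h : ExpMoment μ β L D W) (hL' : 0 < L') (hle : ∀ ω, |W' ω| / L' ≤ |W ω| / L) :
    ExpMoment μ β L' D W' := by
  have hpt : ∀ ω, Real.exp ((|W' ω| / L') ^ β) ≤ Real.exp ((|W ω| / L) ^ β) := fun ω =>
    Real.exp_le_exp.2 (Real.rpow_le_rpow (by positivity) (hle ω) hβ0.le)
  have hi : Integrable (fun ω => Real.exp ((|W' ω| / L') ^ β)) μ := by
    refine h.1.mono'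
      (Measurable.aestronglyMeasurable (by fun_prop))
      (Filter.Eventually.of_forall fun ω => ?_)
    rw [Real.norm_of_nonneg (Real.exp_pos _).le]
    exact hpt ω
  exact ⟨hi, (integral_mono hi h.1 hpt).trans h.2⟩

/-- The exponential is literally unchanged. The new exponent α/2 is at most 1 exactly when α ≤ 2. -/
theorem ExpMoment.sq {α L D : ℝ} (hL : 0 < L) {W : Ω → ℝ} (h : ExpMoment μ α L D W) :
    ExpMoment μ (α / 2) (L ^ 2) D (fun ω => W ω ^ 2) := by
  have : ∀ ω, (|W ω ^ 2| / L ^ 2) ^ (α / 2) = (|W ω| / L) ^ α := fun ω => by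
    rw [abs_pow, ← div_pow, ← Real.rpow_natCast, ← Real.rpow_mul (by positivity)]
    congr 1
    push_cast
    ring
  simpa only [ExpMoment, this] using h

/-- Centring and rescaling preserve exponential moments, up to the constant. -/
theorem exists_expMoment_centred {β D : ℝ} (hβ0 : 0 < β) (hβ1 : β ≤ 1) (hD : 1 ≤ D) :
    ∃ D' : ℝ, 1 ≤ D' ∧ ∀ {Ω : Type*} [MeasurableSpace Ω] (μ : Measure Ω) [IsProbabilityMeasure μ]
      (L : ℝ) (W : Ω → ℝ), 0 < L → Measurable W → ExpMoment μ β L D W →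
      ExpMoment μ β 1 D' (fun ω => (W ω - ∫ ω', W ω' ∂μ) / L) := by
  obtain ⟨c, hc, hle⟩ := exists_pow_le_mul_exp_rpow hβ0 1
  refine ⟨D * Real.exp ((c * D) ^ β), ?_, ?_⟩
  · exact one_le_mul_of_one_le_of_one_le hD (Real.one_le_exp (by positivity))
  intro Ω _ μ _ L W hL hW h
  have hint := h.integrable hβ0 hL hW
  set a := ∫ ω', W ω' ∂μ with ha
  have hmean : |a| / L ≤ c * D := by
    have h1 : |a| ≤ ∫ ω, |W ω| ∂μ := abs_integral_le_integral_abs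
    have h2 : ∫ ω, |W ω| ∂μ ≤ ∫ ω, (c * L) * Real.exp ((|W ω| / L) ^ β) ∂μ := by
      refine integral_mono hint.abs (h.1.const_mul _) fun ω => ?_
      have h3 := hle (|W ω| / L) (by positivity)
      rw [pow_one, div_le_iff₀ hL] at h3
      simp only
      linarith
    rw [integral_const_mul] at h2
    have h4 := mul_le_mul_of_nonneg_left h.2 (mul_nonneg hc hL.le)
    rw [div_le_iff₀ hL]
    linarith
  -- For β ≤ 1 the power is subadditive, so subtracting the mean costs only a constant factor.
  have hpt : ∀ ω, Real.exp ((|(W ω - a) / L| / 1) ^ β) ≤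
      Real.exp ((|W ω| / L) ^ β) * Real.exp ((c * D) ^ β) := fun ω => by
    rw [← Real.exp_add, Real.exp_le_exp, div_one, abs_div, abs_of_pos hL]
    calc (|W ω - a| / L) ^ β ≤ (|W ω| / L + |a| / L) ^ β := by
          rw [← add_div]
          gcongr
          exact abs_sub _ _
      _ ≤ (|W ω| / L) ^ β + (|a| / L) ^ β :=
          Real.rpow_add_le_add_rpow (by positivity) (by positivity) hβ0.le hβ1
      _ ≤ _ := by gcongr
  have hi : Integrable (fun ω => Real.exp ((|(W ω - a) / L| / 1) ^ β)) μ := by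
    refine (h.1.mul_const (Real.exp ((c * D) ^ β))).mono'
      (Measurable.aestronglyMeasurable (by fun_prop))
      (Filter.Eventually.of_forall fun ω => ?_)
    rw [Real.norm_of_nonneg (Real.exp_pos _).le]
    exact hpt ω
  refine ⟨hi, (integral_mono hi (h.1.mul_const _) hpt).trans ?_⟩
  rw [integral_mul_const]
  exact mul_le_mul_of_nonneg_right h.2 (Real.exp_pos _).le

/-- Strictness provides an admissible η < L, so attainment of the infimum is not needed; the 2 is
the 1 subtracted in `psi` plus the bound 1. -/
theorem expMoment_of_psiNorm_lt [IsProbabilityMeasure μ] {α L : ℝ} (hα : 0 < α) {W : Ω → ℝ}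
    (hW : Measurable W) (h : psiNorm μ α W < ENNReal.ofReal L) : ExpMoment μ α L 2 W := by
  simp only [psiNorm, orliczNorm, iInf_lt_iff] at h
  obtain ⟨η, hη, hint, hlt⟩ := h
  have hηL : η < L := (ENNReal.ofReal_lt_ofReal_iff_of_nonneg hη.le).1 hlt
  have hbase : ExpMoment μ α η 2 W := by
    have hmeas : Measurable fun ω => Real.exp ((|W ω| / η) ^ α) := by fun_prop
    have hle : ∫⁻ ω, ENNReal.ofReal (Real.exp ((|W ω| / η) ^ α)) ∂μ ≤ ENNReal.ofReal 2 := by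
      have heq : ∀ ω, ENNReal.ofReal (Real.exp ((|W ω| / η) ^ α)) =
          ENNReal.ofReal (psi α (|W ω| / η)) + 1 := fun ω => by
        rw [← ENNReal.ofReal_one, ← ENNReal.ofReal_add _ zero_le_one, psi, sub_add_cancel]
        exact sub_nonneg.2 (Real.one_le_exp (by positivity))
      simp only [heq]
      rw [lintegral_add_right _ measurable_const, lintegral_const, measure_univ, mul_one,
        show (2 : ℝ) = 1 + 1 by norm_num, ENNReal.ofReal_add zero_le_one zero_le_one,
        ENNReal.ofReal_one]
      gcongr
    have hi : Integrable (fun ω => Real.exp ((|W ω| / η) ^ α)) μ := by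
      refine ⟨hmeas.aestronglyMeasurable, ?_⟩
      rw [hasFiniteIntegral_iff_ofReal (Filter.Eventually.of_forall fun ω => (Real.exp_pos _).le)]
      exact hle.trans_lt ENNReal.ofReal_lt_top
    refine ⟨hi, ?_⟩
    rw [integral_eq_lintegral_of_nonneg_ae
      (Filter.Eventually.of_forall fun ω => (Real.exp_pos _).le) hmeas.aestronglyMeasurable]
    exact ENNReal.toReal_le_of_le_ofReal zero_le_two hle
  exact hbase.of_le hα hW (hη.trans hηL) fun ω => by gcongr

/-- From x ≤ exp x, E|W|^α ≤ 2 L^α for every L > 0. This serves the degenerate case K = 0, where no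
positive scale is available. -/
theorem ae_eq_zero_of_psiNorm_le_zero [IsProbabilityMeasure μ] {α : ℝ} (hα : 0 < α) {W : Ω → ℝ}
    (hW : Measurable W) (h : psiNorm μ α W ≤ 0) : ∀ᵐ ω ∂μ, W ω = 0 := by
  have hexp : ∀ L : ℝ, 0 < L → ExpMoment μ α L 2 W := fun L hL =>
    expMoment_of_psiNorm_lt hα hW (h.trans_lt (ENNReal.ofReal_pos.2 hL))
  have hpt : ∀ L : ℝ, 0 < L → ∀ ω, |W ω| ^ α ≤ L ^ α * Real.exp ((|W ω| / L) ^ α) := by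
    intro L hL ω
    have h1 := (lt_add_one _).le.trans (Real.add_one_le_exp ((|W ω| / L) ^ α))
    rw [Real.div_rpow (abs_nonneg _) hL.le, div_le_iff₀ (by positivity), mul_comm] at h1
    rwa [Real.div_rpow (abs_nonneg _) hL.le]
  have hi : Integrable (fun ω => |W ω| ^ α) μ := by
    refine ((hexp 1 one_pos).1.const_mul (1 ^ α)).mono'
      (Measurable.aestronglyMeasurable (by fun_prop))
      (Filter.Eventually.of_forall fun ω => ?_)
    rw [Real.norm_of_nonneg (by positivity)]
    exact hpt 1 one_pos ω
  have h0 : 0 ≤ ∫ ω, |W ω| ^ α ∂μ := integral_nonneg fun ω => by positivity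
  have hzero : ∫ ω, |W ω| ^ α ∂μ = 0 := by
    by_contra hne
    set δ := ∫ ω, |W ω| ^ α ∂μ
    have hδ : 0 < δ := lt_of_le_of_ne h0 (Ne.symm hne)
    -- At this scale the bound reads δ ≤ δ/2.
    set L := (δ / 4) ^ (1 / α) with hL
    have hL0 : 0 < L := by positivity
    have hLα : L ^ α = δ / 4 := by
      rw [hL, ← Real.rpow_mul (by positivity), one_div_mul_cancel hα.ne', Real.rpow_one]
    have h1 : δ ≤ ∫ ω, L ^ α * Real.exp ((|W ω| / L) ^ α) ∂μ :=
      integral_mono hi ((hexp L hL0).1.const_mul _) (hpt L hL0)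
    rw [integral_const_mul, hLα] at h1
    nlinarith [(hexp L hL0).2]
  rw [integral_eq_zero_iff_of_nonneg (fun ω => by positivity) hi] at hzero
  filter_upwards [hzero] with ω hω
  have := (Real.rpow_eq_zero (abs_nonneg (W ω)) hα.ne').1 hω
  exact abs_eq_zero.1 this

end

/-! ### Sums of variables with stretched-exponential tails -/

/-- For `0 < β` the function `x ↦ exp(x ^ β)` is convex away from the origin. -/
theorem convexOn_exp_rpow {β : ℝ} (hβ0 : 0 < β) :
    ConvexOn ℝ (Set.Ici ((1 / β) ^ (1 / β))) fun x : ℝ => Real.exp (x ^ β) := by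
  set c := (1 / β) ^ (1 / β) with hc
  have hc0 : 0 < c := by positivity
  have hcβ : c ^ β = 1 / β := by
    rw [hc, ← Real.rpow_mul (by positivity), one_div_mul_cancel hβ0.ne', Real.rpow_one]
  have hder : ∀ x : ℝ, 0 < x →
      HasDerivAt (fun x : ℝ => Real.exp (x ^ β)) (Real.exp (x ^ β) * (β * x ^ (β - 1))) x :=
    fun x hx => (Real.hasDerivAt_rpow_const (Or.inl hx.ne')).exp
  refine MonotoneOn.convexOn_of_deriv (convex_Ici c)
    (fun x hx => (hder x (hc0.trans_le hx)).continuousAt.continuousWithinAt) ?_ ?_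
  · rw [interior_Ici]
    exact fun x hx => (hder x (hc0.trans hx)).differentiableAt.differentiableWithinAt
  · rw [interior_Ici]
    intro x hx y hy hxy
    have hx0 : 0 < x := hc0.trans hx
    have hy0 : 0 < y := hc0.trans hy
    rw [(hder x hx0).deriv, (hder y hy0).deriv]
    -- It suffices that z^β + (β - 1) log z increases. On this ray β z^β ≥ 1, so z^β grows at least
    -- as fast as log z.
    have hform : ∀ z : ℝ, 0 < z → Real.exp (z ^ β) * (β * z ^ (β - 1)) =
        β * Real.exp (z ^ β + Real.log z * (β - 1)) := fun z hz => by
      rw [Real.exp_add, Real.rpow_def_of_pos hz (β - 1)]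
      ring
    rw [hform x hx0, hform y hy0]
    refine mul_le_mul_of_nonneg_left (Real.exp_le_exp.2 ?_) hβ0.le
    have hxβ : 1 / β ≤ x ^ β := hcβ ▸ Real.rpow_le_rpow hc0.le (le_of_lt hx) hβ0.le
    have hxyβ : x ^ β ≤ y ^ β := Real.rpow_le_rpow hx0.le hxy hβ0.le
    have hxβ0 : 0 < x ^ β := by positivity
    have h1 : Real.log (y ^ β / x ^ β) ≤ y ^ β / x ^ β - 1 :=
      Real.log_le_sub_one_of_pos (by positivity)
    rw [Real.log_div (by positivity) (by positivity), Real.log_rpow hy0, Real.log_rpow hx0] at h1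
    have h2 : y ^ β / x ^ β - 1 ≤ β * (y ^ β - x ^ β) := by
      rw [div_sub_one hxβ0.ne', div_le_iff₀ hxβ0]
      have : 1 ≤ β * x ^ β := by
        have := mul_le_mul_of_nonneg_left hxβ hβ0.le
        rwa [mul_one_div_cancel hβ0.ne'] at this
      nlinarith
    have h3 : Real.log y - Real.log x ≤ y ^ β - x ^ β := by
      have : β * (Real.log y - Real.log x) ≤ β * (y ^ β - x ^ β) := by linarith
      exact le_of_mul_le_mul_left this hβ0
    have h4 : 0 ≤ Real.log y - Real.log x := sub_nonneg.2 (Real.log_le_log hx0 hxy)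
    nlinarith

/-- Shift all points by c into the region of convexity and apply Jensen; subadditivity of the power
undoes the shift at the price exp(c^β) = exp(1/β). -/
theorem exp_rpow_average_le {β : ℝ} (hβ0 : 0 < β) (hβ1 : β ≤ 1) {ι : Type*} {S : Finset ι}
    (hS : S.Nonempty) {x : ι → ℝ} (hx : ∀ j ∈ S, 0 ≤ x j) :
    Real.exp (((∑ j ∈ S, x j) / S.card) ^ β) ≤
      Real.exp (1 / β) * ((∑ j ∈ S, Real.exp (x j ^ β)) / S.card) := by
  set c := (1 / β) ^ (1 / β) with hc
  have hc0 : 0 < c := by positivity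
  have hcβ : c ^ β = 1 / β := by
    rw [hc, ← Real.rpow_mul (by positivity), one_div_mul_cancel hβ0.ne', Real.rpow_one]
  have hcard : (0 : ℝ) < S.card := by exact_mod_cast hS.card_pos
  have hJ := (convexOn_exp_rpow hβ0).map_sum_le (t := S) (w := fun _ => (S.card : ℝ)⁻¹)
    (p := fun j => c + x j) (fun _ _ => by positivity) (by simp [hcard.ne'])
    fun j hj => le_add_of_nonneg_right (hx j hj)
  have hsum : ∑ j ∈ S, (S.card : ℝ)⁻¹ • (c + x j) = c + (∑ j ∈ S, x j) / S.card := by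
    rw [← Finset.smul_sum, Finset.sum_add_distrib, Finset.sum_const, nsmul_eq_mul, smul_eq_mul]
    field_simp
  rw [hsum] at hJ
  have h0 : 0 ≤ (∑ j ∈ S, x j) / S.card := div_nonneg (Finset.sum_nonneg hx) hcard.le
  calc _ ≤ Real.exp ((c + (∑ j ∈ S, x j) / S.card) ^ β) := by
        gcongr
        linarith
    _ ≤ _ := hJ
    _ ≤ ∑ j ∈ S, (S.card : ℝ)⁻¹ • (Real.exp (1 / β) * Real.exp (x j ^ β)) := by
        refine Finset.sum_le_sum fun j hj => ?_
        rw [smul_eq_mul, smul_eq_mul, ← Real.exp_add, ← hcβ]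
        gcongr
        exact Real.rpow_add_le_add_rpow hc0.le (hx j hj) hβ0.le hβ1
    _ = _ := by
        rw [← Finset.smul_sum, ← Finset.mul_sum, smul_eq_mul]
        ring

/-- A substitute for the triangle inequality when β < 1: the scale grows only linearly in the number
of summands and the constant does not depend on it. -/
theorem expMoment_average {Ω : Type*} [MeasurableSpace Ω] {μ : Measure Ω} {β L D : ℝ}
    (hβ0 : 0 < β) (hβ1 : β ≤ 1) (hL : 0 < L) {ι : Type*} {S : Finset ι}
    (hS : S.Nonempty) {W : ι → Ω → ℝ} (hW : ∀ j, Measurable (W j)) (hW0 : ∀ j ω, 0 ≤ W j ω)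
    (h : ∀ j ∈ S, ExpMoment μ β L D (W j)) :
    ExpMoment μ β (S.card * L) (Real.exp (1 / β) * D) (fun ω => ∑ j ∈ S, W j ω) := by
  have hcard : (0 : ℝ) < S.card := by exact_mod_cast hS.card_pos
  have hpt : ∀ ω, Real.exp ((|∑ j ∈ S, W j ω| / (S.card * L)) ^ β) ≤
      Real.exp (1 / β) * ((∑ j ∈ S, Real.exp ((|W j ω| / L) ^ β)) / S.card) := by
    intro ω
    have h1 := exp_rpow_average_le hβ0 hβ1 hS (x := fun j => |W j ω| / L)
      fun j _ => by positivity
    refine le_of_eq_of_le ?_ h1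
    rw [abs_of_nonneg (Finset.sum_nonneg fun j _ => hW0 j ω), ← Finset.sum_div, div_div,
      mul_comm (S.card : ℝ)]
    simp only [abs_of_nonneg (hW0 _ ω)]
  have hsum : Integrable (fun ω => ∑ j ∈ S, Real.exp ((|W j ω| / L) ^ β)) μ :=
    integrable_finsetSum _ fun j hj => (h j hj).1
  have hint : Integrable (fun ω => Real.exp (1 / β) *
      ((∑ j ∈ S, Real.exp ((|W j ω| / L) ^ β)) / S.card)) μ := (hsum.div_const _).const_mul _
  have hi : Integrable (fun ω => Real.exp ((|∑ j ∈ S, W j ω| / (S.card * L)) ^ β)) μ := by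
    refine hint.mono'
      (Measurable.aestronglyMeasurable (by fun_prop))
      (Filter.Eventually.of_forall fun ω => ?_)
    rw [Real.norm_of_nonneg (Real.exp_pos _).le]
    exact hpt ω
  refine ⟨hi, (integral_mono hi hint hpt).trans ?_⟩
  rw [integral_const_mul, integral_div, integral_finsetSum _ fun j hj => (h j hj).1]
  gcongr
  rw [div_le_iff₀ hcard, mul_comm]
  calc _ ≤ ∑ _j ∈ S, D := Finset.sum_le_sum fun j hj => (h j hj).2
    _ = _ := by simp

/-! ### Gram matrices as quadratic forms, and moment bounds -/

theorem inner_eq_sum {p : ℕ} (x θ : EuclideanSpace ℝ (Fin p)) :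
    inner ℝ x θ = ∑ j, x j * θ j := by
  simp [PiLp.inner_apply, mul_comm]

theorem quadForm_sub {p : ℕ} (A B : Matrix (Fin p) (Fin p) ℝ) (θ : EuclideanSpace ℝ (Fin p)) :
    quadForm (A - B) θ = quadForm A θ - quadForm B θ := by
  simp [quadForm, Matrix.sub_mulVec, dotProduct_sub]

theorem quadForm_smul_sum {p n : ℕ} (a : ℝ) (A : Fin n → Matrix (Fin p) (Fin p) ℝ)
    (θ : EuclideanSpace ℝ (Fin p)) :
    quadForm (a • ∑ i, A i) θ = a * ∑ i, quadForm (A i) θ := by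
  simp [quadForm, Matrix.smul_mulVec, Matrix.sum_mulVec, dotProduct_sum]

theorem quadForm_vecMulVec {p : ℕ} (x θ : EuclideanSpace ℝ (Fin p)) :
    quadForm (Matrix.vecMulVec x.ofLp x.ofLp) θ = (inner ℝ x θ) ^ 2 := by
  rw [quadForm, Matrix.vecMulVec_mulVec, inner_eq_sum]
  simp [dotProduct, Finset.mul_sum, sq, mul_comm, mul_assoc, mul_left_comm]

section
variable {Ω : Type*} [MeasurableSpace Ω] {μ : Measure Ω}

theorem quadForm_integral {p : ℕ} {X : Ω → EuclideanSpace ℝ (Fin p)}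
    (hX : ∀ j l, Integrable (fun ω => X ω j * X ω l) μ) (θ : EuclideanSpace ℝ (Fin p)) :
    quadForm (Matrix.of fun j l => ∫ ω, X ω j * X ω l ∂μ) θ = ∫ ω, (inner ℝ (X ω) θ) ^ 2 ∂μ := by
  have h : ∀ ω, (inner ℝ (X ω) θ) ^ 2 = ∑ j, ∑ l, (θ j * θ l) * (X ω j * X ω l) := fun ω => by
    rw [inner_eq_sum, sq, Finset.sum_mul_sum]
    exact Finset.sum_congr rfl fun j _ => Finset.sum_congr rfl fun l _ => by ring
  simp only [h]
  rw [integral_finsetSum _ fun j _ => integrable_finsetSum _ fun l _ => (hX j l).const_mul _]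
  simp only [quadForm, dotProduct, Matrix.mulVec, Matrix.of_apply, Finset.mul_sum]
  refine Finset.sum_congr rfl fun j _ => ?_
  rw [integral_finsetSum _ fun l _ => (hX j l).const_mul _]
  refine Finset.sum_congr rfl fun l _ => ?_
  rw [integral_const_mul]
  ring

theorem quadForm_gram_sub {n p : ℕ} {X : Fin n → Ω → EuclideanSpace ℝ (Fin p)}
    (hX : ∀ i j l, Integrable (fun ω => X i ω j * X i ω l) μ) (θ : EuclideanSpace ℝ (Fin p))
    (ω : Ω) : quadForm (sampleGram X ω - populationGram μ X) θ =
      (1 / (n : ℝ)) * ∑ i, ((inner ℝ (X i ω) θ) ^ 2 - ∫ ω', (inner ℝ (X i ω') θ) ^ 2 ∂μ) := by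
  rw [quadForm_sub, sampleGram, populationGram, quadForm_smul_sum, quadForm_smul_sum, ← mul_sub,
    ← Finset.sum_sub_distrib]
  simp only [quadForm_vecMulVec, quadForm_integral (hX _)]

/-- A real `sSup` is 0 on an unbounded set, so boundedness is what makes `Upsilon` dominate each
variance average. -/
theorem bddAbove_variance_image [IsProbabilityMeasure μ] {n p k : ℕ}
    {X : Fin n → Ω → EuclideanSpace ℝ (Fin p)} (hX : ∀ i, Measurable (X i))
    (h4 : ∀ i, Integrable (fun ω => ‖X i ω‖ ^ 4) μ) :
    BddAbove ((fun θ : EuclideanSpace ℝ (Fin p) =>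
      (1 / (n : ℝ)) * ∑ i, variance (fun ω => (inner ℝ (X i ω) θ) ^ 2) μ) '' sparseSphere p k) := by
  refine ⟨(1 / (n : ℝ)) * ∑ i, ∫ ω, ‖X i ω‖ ^ 4 ∂μ, ?_⟩
  rintro _ ⟨θ, hθ, rfl⟩
  refine mul_le_mul_of_nonneg_left (Finset.sum_le_sum fun i _ => ?_) (by positivity)
  have hm : Measurable fun ω => (inner ℝ (X i ω) θ) ^ 2 := ((hX i).inner_const).pow_const 2
  refine (variance_le_expectation_sq hm.aestronglyMeasurable).trans ?_
  have hpt : ∀ ω, ((inner ℝ (X i ω) θ) ^ 2) ^ 2 ≤ ‖X i ω‖ ^ 4 := fun ω => by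
    have h1 := abs_real_inner_le_norm (X i ω) θ
    rw [hθ.2, mul_one] at h1
    have h2 := pow_le_pow_left₀ (abs_nonneg _) h1 4
    rw [← pow_mul]
    calc _ = |inner ℝ (X i ω) θ| ^ 4 := (Even.pow_abs (by decide) _).symm
      _ ≤ _ := h2
  exact integral_mono_of_nonneg (Filter.Eventually.of_forall fun ω => sq_nonneg _) (h4 i)
    (Filter.Eventually.of_forall hpt)

theorem integrable_mul_coord [IsFiniteMeasure μ] {p : ℕ} {X : Ω → EuclideanSpace ℝ (Fin p)}
    (hX : Measurable X) (h4 : Integrable (fun ω => ‖X ω‖ ^ 4) μ) (j l : Fin p) :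
    Integrable (fun ω => X ω j * X ω l) μ := by
  refine ((integrable_const (1 : ℝ)).add h4).mono'
    (Measurable.aestronglyMeasurable (by fun_prop)) (Filter.Eventually.of_forall fun ω => ?_)
  have h1 := PiLp.norm_apply_le (X ω) j
  have h2 := PiLp.norm_apply_le (X ω) l
  have h3 := mul_le_mul h1 h2 (norm_nonneg _) (norm_nonneg _)
  rw [norm_mul]
  refine h3.trans ?_
  simp only [Pi.add_apply]
  nlinarith [sq_nonneg (‖X ω‖ ^ 2 - 1), sq_nonneg (‖X ω‖ ^ 2)]

theorem integrable_norm_pow_four {p : ℕ} {X : Ω → EuclideanSpace ℝ (Fin p)}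
    (hX : Measurable X) (h : ∀ j, Integrable (fun ω => X ω j ^ 4) μ) :
    Integrable (fun ω => ‖X ω‖ ^ 4) μ := by
  refine ((integrable_finsetSum Finset.univ fun j _ => h j).const_mul (p : ℝ)).mono'
    (Measurable.aestronglyMeasurable (by fun_prop)) (Filter.Eventually.of_forall fun ω => ?_)
  rw [Real.norm_of_nonneg (by positivity), show ‖X ω‖ ^ 4 = (‖X ω‖ ^ 2) ^ 2 by ring,
    EuclideanSpace.real_norm_sq_eq]
  refine (sq_sum_le_card_mul_sum_sq).trans_eq ?_
  simp only [Finset.card_univ, Fintype.card_fin, ← pow_mul]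

end

/-! ### Fixed-vector deviation and the union bound -/

theorem l0_single_le {p : ℕ} (j : Fin p) : l0 (EuclideanSpace.single j (1 : ℝ)) ≤ 1 := by
  classical
  refine (l0_le_of_forall (S := {j}) fun l hl => ?_).trans_eq (Finset.card_singleton j)
  rw [Finset.mem_singleton] at hl
  simp [hl]

theorem single_mem_sparseSphere {p k : ℕ} (hk : 1 ≤ k) (j : Fin p) :
    EuclideanSpace.single j (1 : ℝ) ∈ sparseSphere p k :=
  ⟨(l0_single_le j).trans hk, by simp⟩

theorem inner_single_one {p : ℕ} (x : EuclideanSpace ℝ (Fin p)) (j : Fin p) :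
    inner ℝ x (EuclideanSpace.single j (1 : ℝ)) = x j := by
  simp [EuclideanSpace.inner_single_right]

/-- Since 36p/k ≥ e, the level τ ≥ 1 required by the concentration bound is available for every t >
0. -/
theorem one_le_add_mul_log {p k : ℕ} (hk : 1 ≤ k) (hkp : k ≤ p) {t : ℝ} (ht : 0 < t) :
    1 ≤ t + (k : ℝ) * Real.log (36 * (p : ℝ) / k) := by
  have hk1 : (1 : ℝ) ≤ k := by exact_mod_cast hk
  have hkp' : (k : ℝ) ≤ p := by exact_mod_cast hkp
  have h1 : Real.exp 1 ≤ 36 * (p : ℝ) / k := by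
    rw [le_div_iff₀ (by linarith)]
    nlinarith [Real.exp_one_lt_d9]
  have h2 := (Real.le_log_iff_exp_le ((Real.exp_pos _).trans_le h1)).2 h1
  nlinarith

/-- Union bound over a set of size at most `(36 p / k) ^ k`. -/
theorem card_mul_exp_neg_le {p k : ℕ} (hk : 1 ≤ k) (hkp : k ≤ p) {N : ℝ}
    (hN : N ≤ (36 * (p : ℝ) / k) ^ k) (t : ℝ) :
    N * (3 * Real.exp (-(t + (k : ℝ) * Real.log (36 * (p : ℝ) / k)))) ≤ 3 * Real.exp (-t) := by
  have hk1 : (0 : ℝ) < k := by exact_mod_cast hk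
  have hp1 : (0 : ℝ) < p := by exact_mod_cast hk.trans hkp
  have hpos : (0 : ℝ) < 36 * (p : ℝ) / k := by positivity
  have h1 : Real.exp (-(t + (k : ℝ) * Real.log (36 * (p : ℝ) / k))) =
      Real.exp (-t) * ((36 * (p : ℝ) / k) ^ k)⁻¹ := by
    rw [neg_add, Real.exp_add, Real.exp_neg ((k : ℝ) * _), mul_comm (k : ℝ), Real.exp_mul,
      Real.exp_log hpos, Real.rpow_natCast]
  rw [h1]
  calc _ = 3 * Real.exp (-t) * (N / (36 * (p : ℝ) / k) ^ k) := by ring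
    _ ≤ 3 * Real.exp (-t) * 1 := by
        gcongr
        exact (div_le_one (by positivity)).2 hN
    _ = _ := mul_one _

/-- Deviation of the quadratic form of the Gram matrices at a fixed sparse unit vector. -/
theorem exists_quadForm_tail {β D : ℝ} (hβ0 : 0 < β) (hβ1 : β ≤ 1) (hD : 1 ≤ D) :
    ∃ C : ℝ, 0 < C ∧ ∀ {n p : ℕ}, 1 ≤ n → ∀ {Ω : Type*} [MeasurableSpace Ω] (μ : Measure Ω)
      [IsProbabilityMeasure μ] (X : Fin n → Ω → EuclideanSpace ℝ (Fin p)) (L τ U : ℝ)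
      (θ : EuclideanSpace ℝ (Fin p)), (∀ i, Measurable (X i)) → iIndepFun X μ → 0 < L → 1 ≤ τ →
      (∀ i j l, Integrable (fun ω => X i ω j * X i ω l) μ) →
      (∀ i, ExpMoment μ β L D fun ω => (inner ℝ (X i ω) θ) ^ 2) →
      (1 / (n : ℝ)) * ∑ i, variance (fun ω => (inner ℝ (X i ω) θ) ^ 2) μ ≤ U →
      μ.real {ω | 3 * √(U * τ / n) + C * L * (Real.log (2 * n)) ^ (1 / β) * τ ^ (1 / β) / n <
        |quadForm (sampleGram X ω - populationGram μ X) θ|} ≤ 3 * Real.exp (-τ) := by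
  obtain ⟨D', hD', hcent⟩ := exists_expMoment_centred hβ0 hβ1 hD
  have hG : 0 < 4 + 4 * Real.log D' := by linarith [Real.log_nonneg hD']
  refine ⟨12 * (4 + 4 * Real.log D') ^ (1 / β), by positivity, ?_⟩
  intro n p hn Ω _ μ _ X L τ U θ hX hind hL hτ hint hexp hU
  have hn' : (1 : ℝ) ≤ n := by exact_mod_cast hn
  have hn0 : (0 : ℝ) < n := by linarith
  have hℓ : 0 ≤ Real.log (2 * n) := Real.log_nonneg (by linarith)
  set W : Fin n → Ω → ℝ := fun i ω => (inner ℝ (X i ω) θ) ^ 2 with hWdef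
  have hW : ∀ i, Measurable (W i) := fun i => ((hX i).inner_const).pow_const 2
  have hWi : ∀ i, Integrable (W i) μ := fun i => (hexp i).integrable hβ0 hL (hW i)
  have hW2 : ∀ i, MemLp (W i) 2 μ := fun i => by
    rw [memLp_two_iff_integrable_sq (hW i).aestronglyMeasurable]
    simpa using (hexp i).integrable_pow hβ0 hL (hW i) 2
  set Y : Fin n → Ω → ℝ := fun i ω => (W i ω - ∫ ω', W i ω' ∂μ) / L with hYdef
  have hY2i : ∀ i, Integrable (fun ω => Y i ω ^ 2) μ := fun i =>
    (memLp_two_iff_integrable_sq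
      (((hW i).sub_const _).div_const L).aestronglyMeasurable).1
      (by simpa [div_eq_mul_inv] using ((hW2 i).sub (memLp_const _)).mul_const L⁻¹)
  have hYind : iIndepFun Y μ := hind.comp
    (fun i x => ((inner ℝ x θ) ^ 2 - ∫ ω', W i ω' ∂μ) / L) fun i => by fun_prop
  have hmean : ∀ i, ∫ ω, Y i ω ∂μ = 0 := fun i => by
    simp only [hYdef]
    rw [integral_div, integral_sub (hWi i) (integrable_const _)]
    simp
  have hvar : ∀ i, ∫ ω, Y i ω ^ 2 ∂μ = variance (W i) μ / L ^ 2 := fun i => by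
    rw [variance_eq_integral (hW i).aemeasurable, ← integral_div]
    simp only [hYdef, div_pow]
  have hmain := measureReal_abs_sum_gt_le hβ0 hβ1 hD' hτ hn
    (fun i => ((hW i).sub_const _).div_const L) hYind
    (fun i => ((hWi i).sub (integrable_const _)).div_const L) hY2i hmean
    fun i => hcent μ L (W i) hL (hW i) (hexp i)
  refine le_trans (measureReal_mono fun ω hω => ?_) hmain
  replace hω : 3 * √(U * τ / n) + 12 * (4 + 4 * Real.log D') ^ (1 / β) * L *
    (Real.log (2 * n)) ^ (1 / β) * τ ^ (1 / β) / n <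
      |quadForm (sampleGram X ω - populationGram μ X) θ| := hω
  change 3 * √((∑ i, ∫ ω, Y i ω ^ 2 ∂μ) * τ) +
        12 * ((4 + 4 * Real.log D') * (Real.log (2 * n) * τ)) ^ (1 / β) < |∑ i, Y i ω|
  -- The Yᵢ are normalised to unit scale, so the whole threshold is multiplied by n/L.
  have hS : |∑ i, Y i ω| = n / L * |quadForm (sampleGram X ω - populationGram μ X) θ| := by
    rw [quadForm_gram_sub hint, ← abs_of_pos (div_pos hn0 hL), ← abs_mul, ← mul_assoc]
    congr 1
    rw [show (n : ℝ) / L * (1 / n) = L⁻¹ by field_simp, Finset.mul_sum]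
    exact Finset.sum_congr rfl fun i _ => by simp only [hYdef, hWdef]; ring
  have hV : √((∑ i, ∫ ω, Y i ω ^ 2 ∂μ) * τ) ≤ n / L * √(U * τ / n) := by
    rw [← Real.sqrt_sq (div_pos hn0 hL).le, ← Real.sqrt_mul (by positivity)]
    refine Real.sqrt_le_sqrt ?_
    simp only [hvar, ← Finset.sum_div]
    rw [one_div, inv_mul_le_iff₀ hn0] at hU
    calc (∑ i, variance (W i) μ) / L ^ 2 * τ ≤ (n * U) / L ^ 2 * τ := by gcongr
      _ = _ := by field_simp
  rw [hS, Real.mul_rpow hG.le (by positivity), Real.mul_rpow hℓ (by positivity)]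
  have h1 := mul_lt_mul_of_pos_left hω (div_pos hn0 hL)
  refine lt_of_le_of_lt ?_ h1
  have h2 : (n : ℝ) / L * (12 * (4 + 4 * Real.log D') ^ (1 / β) * L *
    (Real.log (2 * n)) ^ (1 / β) * τ ^ (1 / β) / n) =
      12 * ((4 + 4 * Real.log D') ^ (1 / β) * ((Real.log (2 * n)) ^ (1 / β) * τ ^ (1 / β))) := by
    field_simp
  rw [mul_add, h2]
  linarith

/-- The uniform bound under exponential moments of all sparse squared projections. -/
theorem exists_RIP_tail {β D : ℝ} (hβ0 : 0 < β) (hβ1 : β ≤ 1) (hD : 1 ≤ D) :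
    ∃ C : ℝ, 0 < C ∧ ∀ {n p k : ℕ}, 1 ≤ n → 1 ≤ k → k ≤ p →
      ∀ {Ω : Type*} [MeasurableSpace Ω] (μ : Measure Ω) [IsProbabilityMeasure μ]
      (X : Fin n → Ω → EuclideanSpace ℝ (Fin p)) (L : ℝ), (∀ i, Measurable (X i)) →
      iIndepFun X μ → 0 < L →
      (∀ i, ∀ θ ∈ sparseSphere p k, ExpMoment μ β L D fun ω => (inner ℝ (X i ω) θ) ^ 2) →
      ∀ t : ℝ, 0 < t → 1 - 3 * Real.exp (-t) ≤ μ.real {ω | RIP μ X k ω ≤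
        14 * √(Upsilon μ X k * (t + (k : ℝ) * Real.log (36 * (p : ℝ) / k)) / n) +
          C * L * (Real.log (2 * n)) ^ (1 / β) *
            (t + (k : ℝ) * Real.log (36 * (p : ℝ) / k)) ^ (1 / β) / n} := by
  obtain ⟨C, hC, htail⟩ := exists_quadForm_tail hβ0 hβ1 hD
  refine ⟨2 * C, by positivity, ?_⟩
  intro n p k hn hk hkp Ω _ μ _ X L hX hind hL hexp t ht
  have hn' : (1 : ℝ) ≤ n := by exact_mod_cast hn
  have hℓ : 0 ≤ Real.log (2 * n) := Real.log_nonneg (by linarith)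
  have hτ := one_le_add_mul_log hk hkp ht
  have hcard3 : ∀ {N : ℝ}, N ≤ (36 * (p : ℝ) / k) ^ k → _ := fun hN =>
    card_mul_exp_neg_le hk hkp hN t
  set τ := t + (k : ℝ) * Real.log (36 * (p : ℝ) / k)
  -- Basis vectors are k-sparse, so the hypothesis on sparse projections already controls every
  -- coordinate.
  have h4 : ∀ i, Integrable (fun ω => ‖X i ω‖ ^ 4) μ := fun i =>
    integrable_norm_pow_four (hX i) fun j => by
      have := (hexp i _ (single_mem_sparseSphere hk j)).integrable_pow hβ0 hL
        (((hX i).inner_const).pow_const 2) 2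
      simpa [inner_single_one, ← pow_mul] using this
  have hint : ∀ i j l, Integrable (fun ω => X i ω j * X i ω l) μ := fun i =>
    integrable_mul_coord (hX i) (h4 i)
  obtain ⟨N, hcard, hN, hsup⟩ := exists_finset_sSup_quadForm_le hk hkp
  set b := 3 * √(Upsilon μ X k * τ / n) +
    C * L * (Real.log (2 * n)) ^ (1 / β) * τ ^ (1 / β) / n with hb
  have hb0 : 0 ≤ b := by positivity
  have hbad : μ.real (⋃ c ∈ N, {ω | b < |quadForm (sampleGram X ω - populationGram μ X) c|}) ≤
      3 * Real.exp (-t) := by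
    refine (measureReal_biUnion_finset_le _ _).trans (le_trans ?_ (hcard3 hcard))
    calc _ ≤ ∑ _c ∈ N, 3 * Real.exp (-τ) := by
          refine Finset.sum_le_sum fun c hc => ?_
          exact htail hn μ X L τ _ c hX hind hL hτ hint (fun i => hexp i c (hN c hc))
            (le_csSup (bddAbove_variance_image hX h4) ⟨c, hN c hc, rfl⟩)
      _ = _ := by rw [Finset.sum_const, nsmul_eq_mul]
  set good := {ω | RIP μ X k ω ≤ 14 * √(Upsilon μ X k * τ / n) +
    2 * C * L * (Real.log (2 * n)) ^ (1 / β) * τ ^ (1 / β) / n} with hgood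
  -- Covering the whole space and using subadditivity avoids any measurability question for the
  -- supremum.
  have hcover : (Set.univ : Set Ω) ⊆ good ∪
      ⋃ c ∈ N, {ω | b < |quadForm (sampleGram X ω - populationGram μ X) c|} := by
    intro ω _
    by_cases h : ∀ c ∈ N, |quadForm (sampleGram X ω - populationGram μ X) c| ≤ b
    · left
      have h1 : RIP μ X k ω ≤ 2 * b := hsup _ b hb0 h
      refine h1.trans ?_
      have h2 := Real.sqrt_nonneg (Upsilon μ X k * τ / n)
      rw [hb]
      have h3 : 2 * (C * L * (Real.log (2 * n)) ^ (1 / β) * τ ^ (1 / β) / n) =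
        2 * C * L * (Real.log (2 * n)) ^ (1 / β) * τ ^ (1 / β) / n := by ring
      linarith
    · right
      push Not at h
      simpa using h
  have h1 := measureReal_mono hcover (μ := μ)
  have h2 := measureReal_union_le (μ := μ) good
    (⋃ c ∈ N, {ω | b < |quadForm (sampleGram X ω - populationGram μ X) c|})
  rw [probReal_univ] at h1
  linarith

/-! ### Sparse projections under norm bounds, and the case K = 0 -/

section
variable {Ω : Type*} [MeasurableSpace Ω] {μ : Measure Ω}

theorem ExpMoment.mono {β L D D' : ℝ} {W : Ω → ℝ} (h : ExpMoment μ β L D W) (hD : D ≤ D') :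
    ExpMoment μ β L D' W :=
  ⟨h.1, h.2.trans hD⟩

/-- Doubling K creates the strict inequality; after squaring it becomes the factor 4 in the final
constant. -/
theorem expMoment_of_psiNorm_le [IsProbabilityMeasure μ] {α : ℝ} {K : ℝ≥0} (hα : 0 < α)
    (hK : 0 < K) {W : Ω → ℝ} (hW : Measurable W) (h : psiNorm μ α W ≤ (K : ℝ≥0∞)) :
    ExpMoment μ α (2 * K) 2 W := by
  refine expMoment_of_psiNorm_lt hα hW (h.trans_lt ?_)
  have hK' : (0 : ℝ) < K := hK
  rw [← ENNReal.ofReal_coe_nnreal]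
  exact (ENNReal.ofReal_lt_ofReal_iff (by positivity)).2 (by linarith)

theorem psiNorm_coord_le_marginalNorm {α : ℝ} {p : ℕ} (X : Ω → EuclideanSpace ℝ (Fin p))
    (j : Fin p) : psiNorm μ α (fun ω => X ω j) ≤ marginalNorm μ α X :=
  le_iSup (fun j : Fin p => psiNorm μ α (fun ω => X ω j)) j

theorem psiNorm_inner_le_jointNorm {α : ℝ} {p : ℕ} (X : Ω → EuclideanSpace ℝ (Fin p))
    {θ : EuclideanSpace ℝ (Fin p)} (hθ : ‖θ‖ = 1) :
    psiNorm μ α (fun ω => inner ℝ (X ω) θ) ≤ jointNorm μ α X :=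
  le_iSup₂ (f := fun (θ : EuclideanSpace ℝ (Fin p)) (_ : ‖θ‖ = 1) =>
    psiNorm μ α (fun ω => inner ℝ (X ω) θ)) θ hθ

theorem marginalNorm_le_jointNorm {α : ℝ} {p : ℕ} (X : Ω → EuclideanSpace ℝ (Fin p)) :
    marginalNorm μ α X ≤ jointNorm μ α X :=
  iSup_le fun j => by
    simpa only [inner_single_one] using
      psiNorm_inner_le_jointNorm X (θ := EuclideanSpace.single j (1 : ℝ)) (by simp)

theorem sq_inner_le_sum_support {p : ℕ} {S : Finset (Fin p)} {θ : EuclideanSpace ℝ (Fin p)}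
    (hS : ∀ j, j ∉ S → θ j = 0) (hθ : ‖θ‖ = 1) (x : EuclideanSpace ℝ (Fin p)) :
    (inner ℝ x θ) ^ 2 ≤ ∑ j ∈ S, x j ^ 2 := by
  have h1 : inner ℝ x θ = ∑ j ∈ S, x j * θ j := by
    rw [inner_eq_sum]
    exact (Finset.sum_subset (Finset.subset_univ S) fun j _ hj => by rw [hS j hj, mul_zero]).symm
  have h2 : ∑ j ∈ S, θ j ^ 2 ≤ 1 := by
    have h3 := EuclideanSpace.real_norm_sq_eq θ
    rw [hθ, one_pow] at h3
    rw [h3]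
    exact Finset.sum_le_sum_of_subset_of_nonneg (Finset.subset_univ S) fun _ _ _ => sq_nonneg _
  rw [h1]
  refine (Finset.sum_mul_sq_le_sq_mul_sq S _ _).trans ?_
  exact mul_le_of_le_one_right (Finset.sum_nonneg fun _ _ => sq_nonneg _) h2

/-- Squared sparse projections under a marginal norm bound: the scale grows by the sparsity. -/
theorem expMoment_sq_inner_of_marginalNorm_le [IsProbabilityMeasure μ] {α : ℝ} {K : ℝ≥0}
    (hα0 : 0 < α) (hα2 : α ≤ 2) (hK : 0 < K) {p k : ℕ} (hk : 1 ≤ k) (hkp : k ≤ p)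
    {X : Ω → EuclideanSpace ℝ (Fin p)} (hX : Measurable X)
    (h : marginalNorm μ α X ≤ (K : ℝ≥0∞)) {θ : EuclideanSpace ℝ (Fin p)}
    (hθ : θ ∈ sparseSphere p k) :
    ExpMoment μ (α / 2) (k * (2 * K) ^ 2) (Real.exp (1 / (α / 2)) * 2)
      fun ω => (inner ℝ (X ω) θ) ^ 2 := by
  have hK' : (0 : ℝ) < K := hK
  have hk' : (0 : ℝ) < k := by exact_mod_cast hk
  obtain ⟨S, hSk, hS⟩ := exists_support hkp hθ.1
  have hcoord : ∀ j, ExpMoment μ (α / 2) ((2 * K) ^ 2) 2 fun ω => X ω j ^ 2 := fun j =>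
    (expMoment_of_psiNorm_le hα0 hK (by fun_prop)
      ((psiNorm_coord_le_marginalNorm X j).trans h)).sq (by positivity)
  have hsum := expMoment_average (half_pos hα0) (by linarith) (by positivity)
    (Finset.card_pos.1 (by omega)) (fun j => by fun_prop) (fun j ω => sq_nonneg (X ω j))
    fun j (_ : j ∈ S) => hcoord j
  rw [hSk] at hsum
  refine hsum.of_le (half_pos hα0) ((hX.inner_const).pow_const 2) (by positivity) fun ω => ?_
  rw [abs_of_nonneg (sq_nonneg _), abs_of_nonneg (Finset.sum_nonneg fun _ _ => sq_nonneg _)]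
  gcongr
  exact sq_inner_le_sum_support hS hθ.2 _

theorem expMoment_sq_inner_of_jointNorm_le [IsProbabilityMeasure μ] {α : ℝ} {K : ℝ≥0}
    (hα0 : 0 < α) (hK : 0 < K) {p k : ℕ} {X : Ω → EuclideanSpace ℝ (Fin p)} (hX : Measurable X)
    (h : jointNorm μ α X ≤ (K : ℝ≥0∞)) {θ : EuclideanSpace ℝ (Fin p)}
    (hθ : θ ∈ sparseSphere p k) :
    ExpMoment μ (α / 2) ((2 * K) ^ 2) 2 fun ω => (inner ℝ (X ω) θ) ^ 2 := by
  have hK' : (0 : ℝ) < K := hK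
  exact (expMoment_of_psiNorm_le hα0 hK hX.inner_const
    ((psiNorm_inner_le_jointNorm X hθ.2).trans h)).sq (by positivity)

theorem ae_RIP_le_zero [IsProbabilityMeasure μ] {α : ℝ} (hα : 0 < α) {n p : ℕ}
    {X : Fin n → Ω → EuclideanSpace ℝ (Fin p)} (hX : ∀ i, Measurable (X i))
    (h : ∀ i, marginalNorm μ α (X i) ≤ 0) (k : ℕ) : ∀ᵐ ω ∂μ, RIP μ X k ω ≤ 0 := by
  have hzero : ∀ i j, ∀ᵐ ω ∂μ, X i ω j = 0 := fun i j =>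
    ae_eq_zero_of_psiNorm_le_zero hα (by fun_prop)
      ((psiNorm_coord_le_marginalNorm (X i) j).trans (h i))
  have hint : ∀ i j l, (fun ω => X i ω j * X i ω l) =ᵐ[μ] fun _ => 0 := fun i j l => by
    filter_upwards [hzero i j] with ω hω
    rw [hω, zero_mul]
  have hall : ∀ᵐ ω ∂μ, ∀ i j, X i ω j = 0 := ae_all_iff.2 fun i => ae_all_iff.2 (hzero i)
  filter_upwards [hall] with ω hω
  refine Real.sSup_le ?_ le_rfl
  rintro _ ⟨θ, -, rfl⟩
  change |quadForm (sampleGram X ω - populationGram μ X) θ| ≤ 0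
  rw [quadForm_gram_sub fun i j l => (integrable_zero _ _ _).congr (hint i j l).symm]
  have h1 : ∀ i, inner ℝ (X i ω) θ = 0 := fun i => by simp [inner_eq_sum, hω i]
  have h2 : ∀ i, ∫ ω', (inner ℝ (X i ω') θ) ^ 2 ∂μ = 0 := fun i => by
    refine integral_eq_zero_of_ae ?_
    filter_upwards [hall] with ω' hω'
    simp [inner_eq_sum, hω' i]
  simp [h1, h2]

theorem one_sub_le_measureReal_RIP_le [IsProbabilityMeasure μ] {α : ℝ} (hα : 0 < α) {n p : ℕ}
    {X : Fin n → Ω → EuclideanSpace ℝ (Fin p)} (hX : ∀ i, Measurable (X i))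
    (h : ∀ i, marginalNorm μ α (X i) ≤ 0) (k : ℕ) (t : ℝ) {r : ℝ} (hr : 0 ≤ r) :
    1 - 3 * Real.exp (-t) ≤ μ.real {ω | RIP μ X k ω ≤ r} := by
  have h1 : μ {ω | RIP μ X k ω ≤ r} = 1 := by
    rw [← measure_univ (μ := μ)]
    refine measure_congr ?_
    filter_upwards [ae_RIP_le_zero hα hX h k] with ω hω
    exact eq_true (hω.trans hr)
  rw [measureReal_def, h1, ENNReal.toReal_one]
  linarith [Real.exp_pos (-t)]

end

end SubWeibull

end

theorem mainTheorem6 (α : ℝ) (hα0 : 0 < α) (hα2 : α ≤ 2) :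
    ∃ C : ℝ, 0 < C ∧
      ∀ (n p k : ℕ), 1 ≤ n → 1 ≤ k → k ≤ p →
      ∀ (Ω : Type*) [MeasurableSpace Ω] (μ : Measure Ω) [IsProbabilityMeasure μ]
        (X : Fin n → Ω → EuclideanSpace ℝ (Fin p)) (K : ℝ≥0),
        (∀ i, Measurable (X i)) → iIndepFun X μ →
        ((∀ i, SubWeibull.marginalNorm μ α (X i) ≤ (K : ℝ≥0∞)) →
          ∀ t : ℝ, 0 < t →
            1 - 3 * Real.exp (-t) ≤
              μ.real {ω | SubWeibull.RIP μ X k ω ≤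
                14 * Real.sqrt (SubWeibull.Upsilon μ X k *
                    (t + (k : ℝ) * Real.log (36 * (p : ℝ) / (k : ℝ))) / (n : ℝ)) +
                  C * (K : ℝ) ^ 2 * (k : ℝ) * (Real.log (2 * (n : ℝ))) ^ (2 / α) *
                    (t + (k : ℝ) * Real.log (36 * (p : ℝ) / (k : ℝ))) ^ (2 / α) / (n : ℝ)}) ∧
        ((∀ i, SubWeibull.jointNorm μ α (X i) ≤ (K : ℝ≥0∞)) →
          ∀ t : ℝ, 0 < t →
            1 - 3 * Real.exp (-t) ≤
              μ.real {ω | SubWeibull.RIP μ X k ω ≤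
                14 * Real.sqrt (SubWeibull.Upsilon μ X k *
                    (t + (k : ℝ) * Real.log (36 * (p : ℝ) / (k : ℝ))) / (n : ℝ)) +
                  C * (K : ℝ) ^ 2 * (Real.log (2 * (n : ℝ))) ^ (2 / α) *
                    (t + (k : ℝ) * Real.log (36 * (p : ℝ) / (k : ℝ))) ^ (2 / α) / (n : ℝ)}) := by
  have hexp1 : 1 ≤ Real.exp (1 / (α / 2)) := Real.one_le_exp (by positivity)
  -- One moment constant, 2 exp(2/α), serves both parts: the marginal case needs it, and the joint
  -- case only needs 2.
  obtain ⟨C, hC, hmain⟩ := SubWeibull.exists_RIP_tail (β := α / 2)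
    (D := Real.exp (1 / (α / 2)) * 2) (half_pos hα0) (by linarith) (by linarith)
  refine ⟨4 * C, by positivity, fun n p k hn hk hkp Ω _ μ _ X K hX hind => ?_⟩
  have hℓ : 0 ≤ Real.log (2 * (n : ℝ)) :=
    Real.log_nonneg (by have : (1 : ℝ) ≤ n := by exact_mod_cast hn
                        linarith)
  rw [one_div_div] at hmain
  constructor
  · intro h t ht
    have hτ := SubWeibull.one_le_add_mul_log hk hkp ht
    -- The general bound needs a positive scale; for K = 0 the vectors vanish almost surely.
    rcases eq_or_ne K 0 with rfl | hK0
    · exact SubWeibull.one_sub_le_measureReal_RIP_le hα0 hX h k t (by positivity)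
    have hK : 0 < K := pos_iff_ne_zero.2 hK0
    have hK' : (0 : ℝ) < K := hK
    have hk' : (0 : ℝ) < k := by exact_mod_cast hk
    have := hmain hn hk hkp μ X (k * (2 * K) ^ 2) hX hind (by positivity) (fun i θ hθ => by
      simpa only [one_div_div] using
        SubWeibull.expMoment_sq_inner_of_marginalNorm_le hα0 hα2 hK hk hkp (hX i) (h i) hθ) t ht
    rwa [show C * (k * (2 * (K : ℝ)) ^ 2) = 4 * C * (K : ℝ) ^ 2 * k by ring] at this
  · intro h t ht
    have hτ := SubWeibull.one_le_add_mul_log hk hkp ht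
    rcases eq_or_ne K 0 with rfl | hK0
    · exact SubWeibull.one_sub_le_measureReal_RIP_le hα0 hX
        (fun i => (SubWeibull.marginalNorm_le_jointNorm _).trans (h i)) k t (by positivity)
    have hK : 0 < K := pos_iff_ne_zero.2 hK0
    have hK' : (0 : ℝ) < K := hK
    have := hmain hn hk hkp μ X ((2 * K) ^ 2) hX hind (by positivity) (fun i θ hθ =>
      (SubWeibull.expMoment_sq_inner_of_jointNorm_le hα0 hK (hX i) (h i) hθ).mono
        (by rw [one_div_div] at hexp1; linarith)) t ht
    rwa [show C * (2 * (K : ℝ)) ^ 2 = 4 * C * (K : ℝ) ^ 2 by ring] at this
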